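/- **Model.** Let $\lambda,z,P_t,f>0$, $\alpha>2$, $m>0$, $0\le r_e<\tau$, $\kappa=(4\pi f/c)^2$ with $c$ the speed of light, and $\bar P_r(r)=P_t\kappa^{-1}(r^2+z^2)^{-\alpha/2}$. Let $G:\mathbb R\to[0,1]$ be a measurable gain pattern with $G(0)=1$. The base stations (BSs) $X_i$ form a homogeneous Poisson point process $\Psi$ of density $\lambda$ on $\{x\in\mathbb R^2: r_e<|x|<\tau\}$. They carry i.i.d. marks $(\xi_i,|h_i|^2)$, independent of $\Psi$, with $\xi_i$ uniform on $[-\pi/3,\pi/3)$ independent of $|h_i|^2$, which is gamma distributed with shape $m$ and scale $1/m$. The active user (AU) is at the origin and is served by the nearest BS $X_0$, at distance $R_0=|X_0|$; probabilities for the AU and the idle user (IU) are conditioned on $\Psi\neq\emptyset$. The IU is at distance $d\ge 0$ from the AU. For a BS at distance $r$ from the AU, seen from the AU at the signed angle $\theta\in(-\pi,\pi]$ (modulo $2\pi$) from the IU, put $W=\sqrt{r^2+d^2-2rd\cos\theta}$ and $\delta=\operatorname{sign}(\theta)\arccos((r-d\cos\theta)/W)$, and write $W_0,\delta_0$ for these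 quantities at $X_0$. The AU receives the signal $S_0(0)=\bar P_r(R_0)|h_0|^2$ and the interference $I_0=\sum_{X_i\neq X_0}\bar P_r(|X_i|)G(\xi_i)|h_i|^2$. The IU receives the signal $S_0(d)=\bar P_r(W_0)\,g\,|h_0|^2$ with $g=G(\delta_0)$ if $|\delta_0|\le\pi/3$ and $g=G(\xi_0)$ otherwise ($\xi_0$ being the random beam direction of the serving BS in its other sectors), and an interference $I_0(d)$ which is assumed to have, conditionally on $X_0$ and $S_0(d)$, the same law as $I_0$. The downlink exposures (EMFE) are $\mathcal P^{AU}=S_0(0)+I_0$, $\mathcal P^{IU}=S_0(d)+I_0(d)$ and, for a random user (RU), $\mathcal P^{RU}=\sum_{X_i\in\Psi}\bar P_r(|X_i|)G(\xi_i)|h_i|^2$ (without conditioning on $\Psi\ne\emptyset$). **Theorem.** (i) $R_0$ has the density $f_{R_0}(r)=\dfrac{2\pi\lambda r\,e^{-\lambda\pi r^2}}{e^{-\lambda\pi r_e^2}-e^{-\lambda\pi\tau^2}}$ on $(r_e,\tau)$. Conditionally on $X_0$ (of polar coordinates $(r,\theta)$), the characteristic functions of $S_0(0)$, $S_0(d)$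 and $I_0$ at $q\in\mathbb R$ are $$\phi_S(q;0|r)=\Bigl(1-\tfrac{jq\bar P_r(r)}{m}\Bigr)^{-m},$$ $$\phi_S(q;d|r,\theta)=\begin{cases}\Bigl(1-\tfrac{jq\bar P_r(W)G(\delta)}{m}\Bigr)^{-m}&\text{if }|\delta|\le\pi/3,\\[1mm] \mathbb E_{\xi,h}\bigl[e^{jq\bar P_r(W)G(\xi)|h|^2}\bigr]&\text{otherwise,}\end{cases}$$ $$\phi_I(q|r)=\exp\Bigl(-\pi\lambda\Bigl(\tau^2-r^2-\mathbb E_{\xi,h}\Bigl[\int_r^\tau 2e^{jq\bar P_r(s)G(\xi)|h|^2}s\,ds\Bigr]\Bigr)\Bigr),$$ and the characteristic function of $\mathcal P^{RU}$ is $\phi_I(q|r_e)$. (ii) For $X\in\{AU,IU,RU\}$ and every real $T_e$ (with $T_e\neq0$ if $X$ is the IU or the RU), $$\mathbb P[\mathcal P^X<T_e]=\frac12-\int_{r_e}^{\tau}\int_0^\infty\frac1{\pi q}\operatorname{Im}\bigl[\phi_E^X(q|r_0)e^{-jqT_e}\bigr]dq\,f_{R_0}(r_0)\,dr_0,$$ where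 $\phi_E^{AU}(q|r_0)=\phi_S(q;0|r_0)\phi_I(q|r_0)$, $\phi_E^{IU}(q|r_0)=\frac1{2\pi}\int_0^{2\pi}\phi_S(q;d|r_0,\theta)\,d\theta\;\phi_I(q|r_0)$ and $\phi_E^{RU}(q|r_0)=\phi_I(q|r_e)$. The inner integral converges as an improper integral $\lim_{b\to\infty}\int_0^b$ for every $r_0\in(r_e,\tau)$, and the outer integrand is integrable. -/

import Mathlib

open MeasureTheory ProbabilityTheory Filter Topology Set

noncomputable section

namespace DownlinkEMFE

/-- Deterministic parameters of the network. Planar positions are complex numbers, with the active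
user at `0` and the idle user at the real point `d`. -/
structure Params where
  /-- density of base stations (BSs) -/
  lam : ℝ
  /-- exclusion radius around a user -/
  re : ℝ
  /-- radius of the network disk -/
  tau : ℝ
  /-- height of the BSs relative to the users -/
  z : ℝ
  /-- effective isotropic radiated power -/
  Pt : ℝ
  /-- carrier frequency -/
  freq : ℝ
  /-- path loss exponent -/
  alpha : ℝ
  /-- Nakagami fading parameter -/
  m : ℝ
  /-- normalized antenna gain pattern -/
  G : ℝ → ℝ
  lam_pos : 0 < lam
  re_nonneg : 0 ≤ re
  re_lt_tau : re < tau
  z_pos : 0 < z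
  Pt_pos : 0 < Pt
  freq_pos : 0 < freq
  two_lt_alpha : 2 < alpha
  m_pos : 0 < m
  measurable_G : Measurable G
  G_nonneg : ∀ x, 0 ≤ G x
  G_le_one : ∀ x, G x ≤ 1
  G_zero : G 0 = 1

namespace Params

variable (p : Params)

/-- `κ = (4 π f / c)²`, with `c` the speed of light in metres per second. -/
def kappa : ℝ := (4 * Real.pi * p.freq / 299792458) ^ 2

/-- Mean received power `P_t κ⁻¹ (r² + z²)^(-α/2)` at horizontal distance `r` under unit gain. -/
def meanPower (r : ℝ) : ℝ := p.Pt * (p.kappa⁻¹ * (r ^ 2 + p.z ^ 2) ^ (-p.alpha / 2))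

/-- The region where BSs can be located: the network disk without the exclusion disk. -/
def region : Set ℂ := {x | p.re < ‖x‖ ∧ ‖x‖ < p.tau}

/-- Mean number of BSs, i.e. density times area of the region. -/
def meanCount : NNReal := Real.toNNReal (p.lam * (Real.pi * (p.tau ^ 2 - p.re ^ 2)))

/-- Uniform law on the sector `[-π/3, π/3)` of the beam direction of an array. -/
def beamLaw : Measure ℝ := (volume : Measure ℝ)[|Ico (-(Real.pi / 3)) (Real.pi / 3)]

/-- Law of the power fading `|h|²`: gamma with shape `m` and scale `1/m` (that is, rate `m`). -/
def fadingLaw : Measure ℝ := gammaMeasure p.m p.m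

/-- The density `f_{R₀}` of the distance between the active user and its serving BS. -/
def servingDensity (r : ℝ) : ℝ :=
  (Ioo p.re p.tau).indicator (fun r =>
    2 * Real.pi * p.lam * r * Real.exp (-p.lam * Real.pi * r ^ 2) /
      (Real.exp (-p.lam * Real.pi * p.re ^ 2) - Real.exp (-p.lam * Real.pi * p.tau ^ 2))) r

end Params

/-- Distance `W = √(R² + d² - 2 R d cos Θ)` between the idle user and a BS at `x = R e^{jΘ}`. -/
def idleDist (d : ℝ) (x : ℂ) : ℝ :=
  √(‖x‖ ^ 2 + d ^ 2 - 2 * ‖x‖ * d * Real.cos x.arg)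

/-- Signed angle `sign(Θ) arccos((R - d cos Θ) / W)` between the active user and the idle user,
seen from a BS at `x = R e^{jΘ}`, with `Θ ∈ (-π, π]`. -/
def idleAngle (d : ℝ) (x : ℂ) : ℝ :=
  Real.sign x.arg * Real.arccos ((‖x‖ - d * Real.cos x.arg) / idleDist d x)

namespace Params

variable (p : Params)

/-- Characteristic function of the useful signal of the active user, at distance `r` from its
serving BS. -/
def cfSignalActive (q r : ℝ) : ℂ :=
  (1 - Complex.I * q * p.meanPower r / p.m) ^ (-(p.m : ℂ))

/-- Characteristic function of the signal received by the idle user from a BS at `x` when this user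
is not in the sector of the active user: the direction of the beam is then random. -/
def etaS (q d : ℝ) (x : ℂ) : ℂ :=
  ∫ w : ℝ × ℝ, Complex.exp (Complex.I * q * p.meanPower (idleDist d x) * p.G w.1 * w.2)
    ∂(beamLaw.prod p.fadingLaw)

open Classical in
/-- Characteristic function of the signal of the idle user, the serving BS being located at `x`. -/
def cfSignalIdle (q d : ℝ) (x : ℂ) : ℂ :=
  if |idleAngle d x| ≤ Real.pi / 3 then
    (1 - Complex.I * q * p.meanPower (idleDist d x) * p.G (idleAngle d x) / p.m) ^ (-(p.m : ℂ))
  else p.etaS q d x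

/-- `η_I(q | r₀) = τ² - r₀² - E_{ξ,h} [∫_{r₀}^τ 2 exp(j q P̄(r) G(ξ) |h|²) r dr]`. -/
def etaI (q r₀ : ℝ) : ℂ :=
  (p.tau : ℂ) ^ 2 - (r₀ : ℂ) ^ 2 -
    ∫ w : ℝ × ℝ, (∫ r in r₀..p.tau,
      2 * Complex.exp (Complex.I * q * p.meanPower r * p.G w.1 * w.2) * (r : ℂ))
      ∂(beamLaw.prod p.fadingLaw)

/-- Characteristic function of the interference, given the distance `r₀` to the serving BS. -/
def cfInterference (q r₀ : ℝ) : ℂ :=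
  Complex.exp (-(Real.pi * p.lam) * p.etaI q r₀)

/-- `φ_E^{AU}(q | r₀)` -/
def cfActive (q r₀ : ℝ) : ℂ := p.cfSignalActive q r₀ * p.cfInterference q r₀

/-- `φ_E^{IU}(q; d | r₀)`: the signal part is averaged over the angle of the serving BS. -/
def cfIdle (d q r₀ : ℝ) : ℂ :=
  ((1 / (2 * Real.pi) : ℝ) : ℂ) *
      (∫ θ in (0 : ℝ)..(2 * Real.pi), p.cfSignalIdle q d (r₀ * Complex.exp (Complex.I * θ))) *
    p.cfInterference q r₀

/-- `φ_E^{RU}(q)`, which does not depend on `r₀`. -/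
def cfRandom (q _r₀ : ℝ) : ℂ := p.cfInterference q p.re

end Params

/-- A homogeneous Poisson point process of BSs on the bounded region, with independent marks: a
Poisson number `N` of BSs at independent uniform positions `X 0, …, X (N - 1)`, independent of `N`.
The `i`-th BS carries an independent beam direction `ξ i` and power fading `H i`. For the serving
BS, whose beam in the sector of the active user points at the active user, `ξ i` is the random
beam direction in its other sectors. -/
structure Network (p : Params) {Ω : Type*} [MeasurableSpace Ω] (μ : Measure Ω) where
  N : Ω → ℕ
  X : ℕ → Ω → ℂ
  ξ : ℕ → Ω → ℝ
  H : ℕ → Ω → ℝ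
  measurable_N : Measurable N
  measurable_X : ∀ i, Measurable (X i)
  measurable_ξ : ∀ i, Measurable (ξ i)
  measurable_H : ∀ i, Measurable (H i)
  map_N : μ.map N = poissonMeasure p.meanCount
  map_mark : ∀ i, μ.map (fun ω => (X i ω, ξ i ω, H i ω)) =
    ((volume : Measure ℂ)[|p.region]).prod (Params.beamLaw.prod p.fadingLaw)
  iIndepFun_mark : iIndepFun (fun i ω => (X i ω, ξ i ω, H i ω)) μ
  indepFun_N : IndepFun N (fun ω (i : ℕ) => (X i ω, ξ i ω, H i ω)) μ

namespace Network

variable {p : Params} {Ω : Type*} [MeasurableSpace Ω] {μ : Measure Ω} (S : Network p μ)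

/-- Index of the serving BS, the nearest one to the active user (if there is any BS). -/
def serving (ω : Ω) : ℕ := sInf {i | i < S.N ω ∧ ∀ k < S.N ω, ‖S.X i ω‖ ≤ ‖S.X k ω‖}

/-- Position of the serving BS. -/
def X₀ (ω : Ω) : ℂ := S.X (S.serving ω) ω

/-- Distance between the active user and the serving BS. -/
def R₀ (ω : Ω) : ℝ := ‖S.X₀ ω‖

/-- Power received at the origin from the `i`-th BS when its beam has a random direction. -/
def randomBeamPower (i : ℕ) (ω : Ω) : ℝ :=
  p.meanPower ‖S.X i ω‖ * p.G (S.ξ i ω) * S.H i ω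

/-- Useful power received by the active user. The gain is `G(0) = 1`. -/
def signalActive (ω : Ω) : ℝ := p.meanPower (S.R₀ ω) * p.G 0 * S.H (S.serving ω) ω

/-- Aggregate interference at the active user. -/
def interference (ω : Ω) : ℝ :=
  ∑ i ∈ (Finset.range (S.N ω)).erase (S.serving ω), S.randomBeamPower i ω

open Classical in
/-- Gain of the serving BS towards the idle user: deterministic if this user is in the sector of the
active user, that of a randomly directed beam otherwise. -/
def gainIdle (d : ℝ) (ω : Ω) : ℝ :=
  if |idleAngle d (S.X₀ ω)| ≤ Real.pi / 3 then p.G (idleAngle d (S.X₀ ω))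
  else p.G (S.ξ (S.serving ω) ω)

/-- Power received by the idle user from the serving BS. -/
def signalIdle (d : ℝ) (ω : Ω) : ℝ :=
  p.meanPower (idleDist d (S.X₀ ω)) * S.gainIdle d ω * S.H (S.serving ω) ω

/-- EMFE of the active user. -/
def emfeActive (ω : Ω) : ℝ := S.signalActive ω + S.interference ω

/-- EMFE of a random user, uncorrelated with any active user: all beams are randomly directed. -/
def emfeRandom (ω : Ω) : ℝ := ∑ i ∈ Finset.range (S.N ω), S.randomBeamPower i ω

/-- The probability measure conditioned on the existence of a serving BS. -/
def served (_S : Network p μ) : Measure Ω := μ[|{ω | 0 < _S.N ω}]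

/-- The modelling convention for the interference `J` at the idle user: given the serving BS and the
signal it sends to the idle user, `J` has the law of the interference at the active user. -/
def IsIdleInterference (d : ℝ) (J : Ω → ℝ) : Prop :=
  IdentDistrib (fun ω => (S.X₀ ω, S.signalIdle d ω, J ω))
    (fun ω => (S.X₀ ω, S.signalIdle d ω, S.interference ω)) S.served S.served

/-- `φ` is the characteristic function of `Y`, conditioned on the serving BS. -/
def HasCondCF (Y : Ω → ℝ) (φ : ℝ → ℂ → ℂ) : Prop :=
  ∀ q : ℝ, S.served[fun ω => Complex.exp (Complex.I * q * Y ω) |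
    MeasurableSpace.comap S.X₀ inferInstance] =ᵐ[S.served] fun ω => φ q (S.X₀ ω)

end Network

/-- The improper integral of `f` over `(0, ∞)` converges, with value `L`. -/
def HasImproperIntegral (f : ℝ → ℝ) (L : ℝ) : Prop :=
  (∀ b : ℝ, 0 < b → IntervalIntegrable f volume 0 b) ∧
    Tendsto (fun b : ℝ => ∫ q in (0 : ℝ)..b, f q) atTop (𝓝 L)

/-- `F = 1/2 - ∫_{r_e}^τ (∫_0^∞ Im[φ(q|r₀) exp(-j q T)] / (π q) dq) f_{R₀}(r₀) dr₀`, including the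
existence of these integrals; the inner one is an improper integral. -/
def IsGilPelaezAverage (p : Params) (φ : ℝ → ℝ → ℂ) (T F : ℝ) : Prop :=
  ∃ L : ℝ → ℝ,
    (∀ r₀ ∈ Ioo p.re p.tau, HasImproperIntegral
      (fun q => 1 / (Real.pi * q) * (φ q r₀ * Complex.exp (-Complex.I * q * T)).im) (L r₀)) ∧
    IntegrableOn (fun r₀ => L r₀ * p.servingDensity r₀) (Ioo p.re p.tau) ∧
    F = 1 / 2 - ∫ r₀ in p.re..p.tau, L r₀ * p.servingDensity r₀

end DownlinkEMFE

end

namespace DownlinkEMFE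

open scoped ENNReal

/-! ### The Dirichlet integral -/

/-! The distribution formula is Gil-Pelaez inversion, applied conditionally on the distance to the
serving BS and then averaged.

Inversion. For an integrable `Y`, `Im[φ(q) e^{-jqT}] / q = E[(Y - T) sinc(q (Y - T))]`. By Fubini,
its integral over `(0, b)` is the mean of the sine integral at `b (Y - T)`. The sine integral is
bounded and tends to `π/2` times the sign, so dominated convergence gives `(P[Y > T] - P[Y < T]) /
2` (`hasImproperIntegral_gilPelaez`). This is `1/2 - P[Y < T]` as soon as `T` is not an atom.

Conditional law. Almost surely exactly one BS is nearest. Given `N = n + 1`, exchangeability makes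
each index contribute equally, and `(n + 1) P[N = n + 1] = Λ P[N = n]`, with `Λ` the mean count,
turns the remaining BSs back into the original process. Thus, given a serving BS at distance `r`,
its beam and fading keep their laws, and the interference is independent of them and distributed as
the total power given that no BS lies within `r` (`lintegral_servingMark_interference`,
`lintegral_served`). Polar coordinates then give the density of `R₀`.

Characteristic functions. Independent factors weighted by Poisson probabilities sum to an
exponential (`setIntegral_clear_cexp`), and division by the void probability leaves `φ_I`. The gamma
law is treated by analytic continuation of its moment generating function.

Atoms. The fading has no atom, so neither does any power with nonzero gain. The signal of the active
user always has nonzero gain, so every `T` is allowed. The other exposures may vanish with positive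
probability, whence `T ≠ 0`. -/

theorem intervalIntegral_sin_mul_exp_neg (b t : ℝ) :
    ∫ x in (0 : ℝ)..b, Real.sin x * Real.exp (-(t * x)) =
      (1 - Real.exp (-(t * b)) * (t * Real.sin b + Real.cos b)) * (1 + t ^ 2)⁻¹ := by
  have h : ∀ x : ℝ, HasDerivAt
      (fun x => -(Real.exp (-(t * x)) * (t * Real.sin x + Real.cos x)) * (1 + t ^ 2)⁻¹)
      (Real.sin x * Real.exp (-(t * x))) x := by
    intro x
    have h1 : HasDerivAt (fun x => Real.exp (-(t * x))) (Real.exp (-(t * x)) * -(t * 1)) x :=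
      (((hasDerivAt_id x).const_mul t).neg).exp
    have h2 : HasDerivAt (fun x => t * Real.sin x + Real.cos x)
        (t * Real.cos x + -Real.sin x) x :=
      ((Real.hasDerivAt_sin x).const_mul t).add (Real.hasDerivAt_cos x)
    have : 1 + t ^ 2 ≠ 0 := by positivity
    refine (((h1.mul h2).neg).mul_const ((1 + t ^ 2)⁻¹)).congr_deriv ?_
    symm
    rw [eq_mul_inv_iff_mul_eq₀ this]
    ring
  rw [intervalIntegral.integral_eq_sub_of_hasDerivAt (fun x _ => h x)
    (Continuous.intervalIntegrable (by fun_prop) _ _)]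
  simp
  ring

/-- For `x > 0` the `t`-integral of `|sin x| e^{-tx}` is `|sin x| / x ≤ 1`, and `(0, b]` has finite
length. -/
theorem integrable_sin_mul_exp_neg_prod (b : ℝ) :
    Integrable (Function.uncurry fun x t : ℝ => Real.sin x * Real.exp (-(t * x)))
      ((volume.restrict (Ioc 0 b)).prod (volume.restrict (Ioi 0))) := by
  have hint : ∀ x : ℝ, 0 < x →
      ∫ t in Ioi (0 : ℝ), Real.exp (-(t * x)) = x⁻¹ ∧
      IntegrableOn (fun t : ℝ => Real.exp (-(t * x))) (Ioi 0) := by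
    intro x hx
    have e : (fun t : ℝ => Real.exp (-(t * x))) = fun t => Real.exp (-x * t) := by
      ext t; ring_nf
    rw [e]
    refine ⟨?_, integrableOn_exp_mul_Ioi (by linarith) _⟩
    rw [integral_exp_mul_Ioi (by linarith)]
    simp [neg_div_neg_eq]
  rw [integrable_prod_iff (by
    apply Continuous.aestronglyMeasurable
    unfold Function.uncurry
    fun_prop)]
  constructor
  · filter_upwards [ae_restrict_mem measurableSet_Ioc] with x hx
    exact ((hint x hx.1).2).const_mul (Real.sin x)
  · have : IntegrableOn (fun _ : ℝ => (1 : ℝ)) (Ioc 0 b) := by simp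
    refine Integrable.mono' this ?_ ?_
    · refine AEStronglyMeasurable.norm (f := fun x : ℝ × ℝ => Function.uncurry (fun x t : ℝ =>
        Real.sin x * Real.exp (-(t * x))) x) ?_ |>.integral_prod_right'
      apply Continuous.aestronglyMeasurable
      unfold Function.uncurry
      fun_prop
    · filter_upwards [ae_restrict_mem measurableSet_Ioc] with x hx
      simp only [Function.uncurry, norm_mul, Real.norm_eq_abs, Real.abs_exp]
      rw [integral_const_mul, (hint x hx.1).1, abs_mul, abs_abs, abs_inv, abs_of_pos hx.1,
        ← div_eq_mul_inv, div_le_one hx.1]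
      exact (Real.abs_sin_le_abs).trans (abs_of_pos hx.1).le

/-- Write `1/x` as the integral of `e^{-tx}` over `t > 0` and exchange the integrals. -/
theorem intervalIntegral_sinc_eq {b : ℝ} (hb : 0 < b) :
    ∫ x in (0 : ℝ)..b, Real.sinc x =
      ∫ t in Ioi (0 : ℝ),
        (1 - Real.exp (-(t * b)) * (t * Real.sin b + Real.cos b)) * (1 + t ^ 2)⁻¹ := by
  simp_rw [← intervalIntegral_sin_mul_exp_neg]
  simp_rw [intervalIntegral.integral_of_le hb.le]
  rw [← integral_integral_swap (integrable_sin_mul_exp_neg_prod b)]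
  refine setIntegral_congr_fun measurableSet_Ioc fun x hx => ?_
  have e : (fun t : ℝ => Real.sin x * Real.exp (-(t * x))) =
      fun t => Real.sin x * Real.exp (-x * t) := by
    ext t; ring_nf
  rw [e, integral_const_mul, integral_exp_mul_Ioi (by linarith [hx.1]),
    Real.sinc_of_ne_zero hx.1.ne']
  simp [div_eq_mul_inv]

theorem tendsto_intervalIntegral_sinc_atTop :
    Tendsto (fun b : ℝ => ∫ x in (0 : ℝ)..b, Real.sinc x) atTop (𝓝 (Real.pi / 2)) := by
  have key : Tendsto (fun b : ℝ => ∫ t in Ioi (0 : ℝ),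
        (1 - Real.exp (-(t * b)) * (t * Real.sin b + Real.cos b)) * (1 + t ^ 2)⁻¹) atTop
      (𝓝 (∫ t in Ioi (0 : ℝ), (1 + t ^ 2)⁻¹)) := by
    have hbd : ∀ t b : ℝ, 0 < t → |Real.exp (-(t * b)) * (t * Real.sin b + Real.cos b)| ≤
        Real.exp (-(t * b)) * (t + 1) := by
      intro t b ht
      rw [abs_mul, Real.abs_exp]
      gcongr
      refine (abs_add_le _ _).trans ?_
      rw [abs_mul, abs_of_pos ht]
      have := Real.abs_sin_le_one b
      have := Real.abs_cos_le_one b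
      nlinarith
    refine tendsto_integral_filter_of_dominated_convergence
      (fun t : ℝ => 2 * (1 + t ^ 2)⁻¹) ?_ ?_ ?_ ?_
    · refine Eventually.of_forall fun b => Measurable.aestronglyMeasurable (by fun_prop)
    · filter_upwards [eventually_ge_atTop 1] with b hb
      filter_upwards [ae_restrict_mem measurableSet_Ioi] with t ht
      have ht' : 0 < t := ht
      rw [norm_mul, Real.norm_eq_abs, Real.norm_eq_abs,
        abs_of_pos (show 0 < (1 + t ^ 2)⁻¹ by positivity)]
      gcongr
      -- For `b ≥ 1`, `t + 1 ≤ t b + 1 ≤ e^{tb}`; this gives a dominating function free of `b`.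
      have h2 : Real.exp (-(t * b)) * (t + 1) ≤ 1 := by
        have : t + 1 ≤ Real.exp (t * b) := by
          have := Real.add_one_le_exp (t * b)
          nlinarith
        rw [Real.exp_neg]
        rw [inv_mul_le_iff₀ (Real.exp_pos _)]
        linarith
      calc |1 - Real.exp (-(t * b)) * (t * Real.sin b + Real.cos b)|
          ≤ |(1 : ℝ)| + |Real.exp (-(t * b)) * (t * Real.sin b + Real.cos b)| := abs_sub _ _
        _ ≤ 2 := by
          rw [abs_one]; linarith [hbd t b ht']
    · exact (integrable_inv_one_add_sq.integrableOn).const_mul 2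
    · filter_upwards [ae_restrict_mem measurableSet_Ioi] with t ht
      have ht' : 0 < t := ht
      have h0 : Tendsto (fun b : ℝ => Real.exp (-(t * b)) * (t + 1)) atTop (𝓝 (0 * (t + 1))) := by
        refine Tendsto.mul_const _ ?_
        exact Real.tendsto_exp_neg_atTop_nhds_zero.comp (tendsto_id.const_mul_atTop ht')
      rw [zero_mul] at h0
      have h1 := squeeze_zero_norm (fun b => by
        rw [Real.norm_eq_abs]; exact hbd t b ht') h0
      have h2 := (h1.const_sub 1).mul_const ((1 + t ^ 2)⁻¹)
      simpa using h2
  rw [integral_Ioi_inv_one_add_sq] at key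
  simp only [Real.arctan_zero, sub_zero] at key
  refine key.congr' ?_
  filter_upwards [eventually_gt_atTop 0] with b hb
  exact (intervalIntegral_sinc_eq hb).symm

theorem intervalIntegral_sinc_neg (b : ℝ) :
    ∫ x in (0 : ℝ)..(-b), Real.sinc x = -∫ x in (0 : ℝ)..b, Real.sinc x := by
  have := intervalIntegral.integral_comp_neg (a := 0) (b := b) Real.sinc
  simp only [Real.sinc_neg, neg_zero] at this
  rw [this, ← intervalIntegral.integral_symm]

theorem continuous_intervalIntegral_sinc :
    Continuous fun b : ℝ => ∫ x in (0 : ℝ)..b, Real.sinc x :=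
  intervalIntegral.continuous_primitive
    (fun _ _ => Real.continuous_sinc.intervalIntegrable _ _) 0

/-- The limit controls large arguments, compactness the bounded ones, and oddness the negative ones.
The constant serves as dominating function in the inversion formula. -/
theorem exists_abs_intervalIntegral_sinc_le :
    ∃ C : ℝ, ∀ b : ℝ, |∫ x in (0 : ℝ)..b, Real.sinc x| ≤ C := by
  obtain ⟨M, hM⟩ := eventually_atTop.1 ((tendsto_intervalIntegral_sinc_atTop.norm).eventually
    (ge_mem_nhds (lt_add_one _)))
  obtain ⟨C, hC⟩ := (isCompact_Icc (a := 0) (b := M)).exists_bound_of_continuousOn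
    continuous_intervalIntegral_sinc.continuousOn
  have hpos : ∀ b : ℝ, 0 ≤ b → |∫ x in (0 : ℝ)..b, Real.sinc x| ≤ max C (‖Real.pi / 2‖ + 1) := by
    intro b hb
    rcases le_total b M with h | h
    · exact (hC b ⟨hb, h⟩).trans (le_max_left _ _)
    · exact (hM b h).trans (le_max_right _ _)
  refine ⟨max C (‖Real.pi / 2‖ + 1), fun b => ?_⟩
  rcases le_total 0 b with h | h
  · exact hpos b h
  · have := hpos (-b) (by linarith)
    rwa [intervalIntegral_sinc_neg, abs_neg] at this

/-- The convention `Real.sign 0 = 0` covers `x = 0`, which is how an atom of `Y` at `T` drops out of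
the limit. -/
theorem tendsto_intervalIntegral_sinc_mul (x : ℝ) :
    Tendsto (fun b : ℝ => ∫ t in (0 : ℝ)..(b * x), Real.sinc t) atTop
      (𝓝 (Real.pi / 2 * Real.sign x)) := by
  rcases lt_trichotomy x 0 with h | h | h
  · have h1 : Tendsto (fun b : ℝ => b * -x) atTop atTop := tendsto_id.atTop_mul_const (by linarith)
    have h2 := (tendsto_intervalIntegral_sinc_atTop.comp h1).neg
    rw [Real.sign_of_neg h]
    refine (h2.congr fun b => ?_).trans (by simp)
    simp only [Function.comp]
    rw [← intervalIntegral_sinc_neg]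
    simp
  · simp [h]
  · rw [Real.sign_of_pos h, mul_one]
    exact tendsto_intervalIntegral_sinc_atTop.comp (tendsto_id.atTop_mul_const h)

theorem intervalIntegral_mul_sinc_mul (x b : ℝ) :
    ∫ q in (0 : ℝ)..b, x * Real.sinc (q * x) = ∫ t in (0 : ℝ)..(b * x), Real.sinc t := by
  rw [intervalIntegral.integral_const_mul, ← smul_eq_mul,
    intervalIntegral.smul_integral_comp_mul_right, zero_mul]

/-! ### The Gil-Pelaez inversion formula -/

theorem integral_sign_sub {α : Type*} [MeasurableSpace α] {π : Measure α} [IsProbabilityMeasure π]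
    {Y : α → ℝ} (hY : Measurable Y) (T : ℝ) :
    ∫ a, Real.sign (Y a - T) ∂π = π.real {a | T < Y a} - π.real {a | Y a < T} := by
  have e : (fun a => Real.sign (Y a - T)) =
      fun a => {a | T < Y a}.indicator (fun _ => (1 : ℝ)) a -
        {a | Y a < T}.indicator (fun _ => (1 : ℝ)) a := by
    ext a
    rcases lt_trichotomy (Y a) T with h | h | h
    · simp [Real.sign_of_neg (sub_neg.2 h), h, h.le]
    · simp [h]
    · simp [Real.sign_of_pos (sub_pos.2 h), h, h.le]
  have m1 : MeasurableSet {a | T < Y a} := measurableSet_lt measurable_const hY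
  have m2 : MeasurableSet {a | Y a < T} := measurableSet_lt hY measurable_const
  rw [e, integral_sub ((integrable_const _).indicator m1) ((integrable_const _).indicator m2),
    integral_indicator_const _ m1, integral_indicator_const _ m2]
  simp

/-- Gil-Pelaez inversion, for an integrable random variable and an arbitrary threshold. -/
theorem hasImproperIntegral_gilPelaez {α : Type*} [MeasurableSpace α] {π : Measure α}
    [IsProbabilityMeasure π] {Y : α → ℝ} (hY : Measurable Y) (hi : Integrable Y π) (T : ℝ)
    {φ : ℝ → ℂ} (hφ : ∀ q : ℝ, ∫ a, Complex.exp (Complex.I * q * Y a) ∂π = φ q) :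
    HasImproperIntegral
      (fun q => 1 / (Real.pi * q) * (φ q * Complex.exp (-Complex.I * q * T)).im)
      ((π.real {a | T < Y a} - π.real {a | Y a < T}) / 2) := by
  have hexp : ∀ q : ℝ, (φ q * Complex.exp (-Complex.I * q * T)).im =
      ∫ a, Real.sin (q * (Y a - T)) ∂π := by
    intro q
    rw [← hφ, ← integral_mul_const]
    have e : (fun a => Complex.exp (Complex.I * q * Y a) * Complex.exp (-Complex.I * q * T)) =
        fun a => Complex.exp ((q * (Y a - T) : ℝ) * Complex.I) := by
      ext a
      rw [← Complex.exp_add]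
      congr 1
      push_cast
      ring
    rw [e]
    have hint : Integrable (fun a => Complex.exp ((q * (Y a - T) : ℝ) * Complex.I)) π := by
      refine Integrable.of_bound (Measurable.aestronglyMeasurable (by fun_prop)) 1
        (Eventually.of_forall fun a => ?_)
      rw [Complex.norm_exp_ofReal_mul_I]
    rw [← RCLike.im_eq_complex_im, ← integral_im hint]
    simp only [RCLike.im_eq_complex_im, Complex.exp_ofReal_mul_I_im]
  -- At `q = 0` division by zero makes the left side vanish, while the right side is `π⁻¹ E[Y - T]`;
  -- hence only an almost everywhere identity.
  have hfun : ∀ q : ℝ, q ≠ 0 → 1 / (Real.pi * q) * (φ q * Complex.exp (-Complex.I * q * T)).im =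
      Real.pi⁻¹ * ∫ a, (Y a - T) * Real.sinc (q * (Y a - T)) ∂π := by
    intro q hq
    rw [hexp, one_div, mul_inv, mul_assoc, ← integral_const_mul]
    congr 2
    ext a
    by_cases h : Y a - T = 0
    · simp [h]
    · rw [Real.sinc_of_ne_zero (mul_ne_zero hq h)]
      field_simp
  have hae : ∀ᵐ q : ℝ, 1 / (Real.pi * q) * (φ q * Complex.exp (-Complex.I * q * T)).im =
      Real.pi⁻¹ * ∫ a, (Y a - T) * Real.sinc (q * (Y a - T)) ∂π := by
    filter_upwards [Measure.ae_ne volume (0 : ℝ)] with q hq using hfun q hq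
  have hmeas : Measurable (Function.uncurry fun (q : ℝ) (a : α) =>
      (Y a - T) * Real.sinc (q * (Y a - T))) := by
    unfold Function.uncurry
    exact ((hY.comp measurable_snd).sub_const T).mul
      (Real.continuous_sinc.measurable.comp
        (measurable_fst.mul ((hY.comp measurable_snd).sub_const T)))
  -- Since `|sinc| ≤ 1`, the integrand is bounded by `|Y - T|`; this is where integrability of `Y`
  -- enters.
  have hprod : ∀ b : ℝ, Integrable (Function.uncurry fun (q : ℝ) (a : α) =>
      (Y a - T) * Real.sinc (q * (Y a - T))) ((volume.restrict (Ioc 0 b)).prod π) := by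
    intro b
    have h1 : Integrable (fun z : ℝ × α => Y z.2 - T) ((volume.restrict (Ioc 0 b)).prod π) :=
      (hi.sub (integrable_const T)).comp_snd _
    refine h1.mono hmeas.aestronglyMeasurable (Eventually.of_forall fun z => ?_)
    simp only [Function.uncurry, norm_mul]
    exact mul_le_of_le_one_right (norm_nonneg _) (Real.abs_sinc_le_one _)
  constructor
  · intro b hb
    rw [intervalIntegrable_iff_integrableOn_Ioc_of_le hb.le]
    refine Integrable.congr ((hprod b).integral_prod_left.const_mul Real.pi⁻¹) ?_
    filter_upwards [ae_restrict_of_ae hae] with q hq using hq.symm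
  · obtain ⟨C, hC⟩ := exists_abs_intervalIntegral_sinc_le
    have hlim : Tendsto (fun b : ℝ => ∫ a, (∫ t in (0 : ℝ)..(b * (Y a - T)), Real.sinc t) ∂π) atTop
        (𝓝 (∫ a, Real.pi / 2 * Real.sign (Y a - T) ∂π)) := by
      refine tendsto_integral_filter_of_dominated_convergence (fun _ => C) ?_ ?_
        (integrable_const C) ?_
      · refine Eventually.of_forall fun b => Measurable.aestronglyMeasurable ?_
        exact continuous_intervalIntegral_sinc.measurable.comp ((hY.sub_const T).const_mul b)
      · exact Eventually.of_forall fun b => Eventually.of_forall fun a => hC _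
      · exact Eventually.of_forall fun a => tendsto_intervalIntegral_sinc_mul _
    rw [integral_const_mul, integral_sign_sub hY] at hlim
    have hlim' := hlim.const_mul Real.pi⁻¹
    have e : Real.pi⁻¹ * (Real.pi / 2 * (π.real {a | T < Y a} - π.real {a | Y a < T})) =
        (π.real {a | T < Y a} - π.real {a | Y a < T}) / 2 := by
      field_simp
    rw [e] at hlim'
    refine hlim'.congr' ?_
    filter_upwards [eventually_gt_atTop 0] with b hb
    rw [intervalIntegral.integral_congr_ae (hae.mono fun q hq _ => hq),
      intervalIntegral.integral_const_mul]
    congr 1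
    rw [intervalIntegral.integral_of_le hb.le, integral_integral_swap (hprod b)]
    refine integral_congr_ae (Eventually.of_forall fun a => ?_)
    simp only
    rw [← intervalIntegral.integral_of_le hb.le, intervalIntegral_mul_sinc_mul]

/-! ### Gamma distribution -/

/-- Exponential tilting: `e^{tx}` times the gamma density of rate `r` is a multiple of the gamma
density of rate `r - t`. -/
theorem lintegral_exp_mul_gammaMeasure {a r t : ℝ} (ha : 0 < a) (hr : 0 < r) (ht : t < r) :
    ∫⁻ x, ENNReal.ofReal (Real.exp (t * x)) ∂(gammaMeasure a r) =
      ENNReal.ofReal ((r / (r - t)) ^ a) := by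
  have hrt : 0 < r - t := by linarith
  have hpos : 0 < Real.Gamma a := Real.Gamma_pos_of_pos ha
  have hm : ∀ r, Measurable (gammaPDF a r) := fun r =>
    (measurable_gammaPDFReal a r).ennreal_ofReal
  have e : ∀ x, gammaPDF a r x * ENNReal.ofReal (Real.exp (t * x)) =
      ENNReal.ofReal ((r / (r - t)) ^ a) * gammaPDF a (r - t) x := by
    intro x
    rcases lt_or_ge x 0 with hx | hx
    · simp [gammaPDF_of_neg hx]
    · rw [gammaPDF_of_nonneg hx, gammaPDF_of_nonneg hx, ← ENNReal.ofReal_mul (by positivity),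
        ← ENNReal.ofReal_mul (by positivity), Real.div_rpow hr.le hrt.le]
      congr 1
      have h1 : (r - t) ^ a ≠ 0 := (Real.rpow_pos_of_pos hrt a).ne'
      have h2 : Real.exp (-((r - t) * x)) = Real.exp (-(r * x)) * Real.exp (t * x) := by
        rw [← Real.exp_add]; ring_nf
      rw [h2]
      field_simp
  unfold gammaMeasure
  rw [lintegral_withDensity_eq_lintegral_mul _ (hm r) (by fun_prop)]
  simp only [Pi.mul_apply, e]
  rw [lintegral_const_mul _ (hm _), lintegral_gammaPDF_eq_one ha hrt, mul_one]

theorem integrable_exp_mul_gammaMeasure {a r t : ℝ} (ha : 0 < a) (hr : 0 < r) (ht : t < r) :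
    Integrable (fun x => Real.exp (t * x)) (gammaMeasure a r) := by
  refine ⟨Measurable.aestronglyMeasurable (by fun_prop), ?_⟩
  rw [hasFiniteIntegral_iff_ofReal (Eventually.of_forall fun x => (Real.exp_pos _).le),
    lintegral_exp_mul_gammaMeasure ha hr ht]
  exact ENNReal.ofReal_lt_top

theorem mgf_id_gammaMeasure {a r t : ℝ} (ha : 0 < a) (hr : 0 < r) (ht : t < r) :
    mgf id (gammaMeasure a r) t = (r / (r - t)) ^ a := by
  have hrt : 0 < r - t := by linarith
  simp only [mgf, id]
  rw [integral_eq_lintegral_of_nonneg_ae (Eventually.of_forall fun x => (Real.exp_pos _).le)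
    (Measurable.aestronglyMeasurable (by fun_prop)), lintegral_exp_mul_gammaMeasure ha hr ht,
    ENNReal.toReal_ofReal (by positivity)]

theorem mem_interior_integrableExpSet_gammaMeasure {a r t : ℝ} (ha : 0 < a) (hr : 0 < r)
    (ht : t < r) : t ∈ interior (integrableExpSet id (gammaMeasure a r)) :=
  mem_interior.2 ⟨Iio r, fun _ hs => integrable_exp_mul_gammaMeasure ha hr hs, isOpen_Iio, ht⟩

theorem integrable_id_gammaMeasure {a r : ℝ} (ha : 0 < a) (hr : 0 < r) :
    Integrable (fun x : ℝ => x) (gammaMeasure a r) :=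
  integrable_of_mem_interior_integrableExpSet
    (mem_interior_integrableExpSet_gammaMeasure ha hr hr)

/-- Both sides are analytic on the half-plane `Re z < r`, where `1 - z / r` has positive real part
and so avoids the branch cut. They agree at real points accumulating at `0`, and the half-plane is
connected. -/
theorem complexMGF_id_gammaMeasure {a r : ℝ} (ha : 0 < a) (hr : 0 < r) {z : ℂ} (hz : z.re < r) :
    complexMGF id (gammaMeasure a r) z = (1 - z / r) ^ (-(a : ℂ)) := by
  set U : Set ℂ := {z | z.re < r}
  have hU : IsOpen U := isOpen_lt Complex.continuous_re continuous_const
  have hre : ∀ w ∈ U, 0 < (1 - w / r).re := by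
    intro w hw
    have hw' : w.re < r := hw
    rw [Complex.sub_re, Complex.one_re, Complex.div_ofReal_re, sub_pos, div_lt_one hr]
    exact hw'
  have h1 : AnalyticOnNhd ℂ (complexMGF id (gammaMeasure a r)) U := fun w hw =>
    analyticAt_complexMGF (mem_interior_integrableExpSet_gammaMeasure ha hr hw)
  have h2 : AnalyticOnNhd ℂ (fun w : ℂ => (1 - w / r) ^ (-(a : ℂ))) U := by
    refine DifferentiableOn.analyticOnNhd ?_ hU
    intro w hw
    refine DifferentiableAt.differentiableWithinAt ?_
    refine DifferentiableAt.cpow (by fun_prop) (by fun_prop) (Or.inl (hre w hw))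
  have hconv : IsPreconnected U := (convex_halfSpace_re_lt r).isPreconnected
  refine h1.eqOn_of_preconnected_of_frequently_eq h2 hconv (z₀ := 0) (by simpa [U] using hr) ?_ hz
  have hev : ∀ t : ℝ, t < r → complexMGF id (gammaMeasure a r) t =
      (1 - (t : ℂ) / r) ^ (-(a : ℂ)) := by
    intro t ht
    have hp : 0 < 1 - t / r := by rw [sub_pos, div_lt_one hr]; exact ht
    rw [complexMGF_ofReal, mgf_id_gammaMeasure ha hr ht]
    have : (1 - (t : ℂ) / r) = ((1 - t / r : ℝ) : ℂ) := by push_cast; rfl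
    rw [this, ← Complex.ofReal_neg, ← Complex.ofReal_cpow hp.le, Real.rpow_neg hp.le,
      ← Real.inv_rpow hp.le]
    congr 2
    field_simp
  have hseq : Tendsto (fun t : ℝ => (t : ℂ)) (𝓝[≠] 0) (𝓝[≠] 0) := by
    refine tendsto_nhdsWithin_of_tendsto_nhds_of_eventually_within _ ?_ ?_
    · exact (Complex.continuous_ofReal.tendsto' 0 0 (by simp)).mono_left nhdsWithin_le_nhds
    · filter_upwards [self_mem_nhdsWithin] with t ht
      simpa using ht
  refine hseq.frequently (Eventually.frequently ?_)
  filter_upwards [nhdsWithin_le_nhds (Iio_mem_nhds hr)] with t ht using hev t ht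

theorem integral_cexp_gammaMeasure {a r : ℝ} (ha : 0 < a) (hr : 0 < r) (t : ℝ) :
    ∫ x : ℝ, Complex.exp (Complex.I * t * x) ∂(gammaMeasure a r) =
      (1 - Complex.I * t / r) ^ (-(a : ℂ)) :=
  complexMGF_id_gammaMeasure ha hr (z := Complex.I * t) (by simpa using hr)

instance instNullSingletonClassGammaMeasure (a r : ℝ) :
    NullSingletonClass (gammaMeasure a r) where
  measure_singleton x := withDensity_absolutelyContinuous _ _ (measure_singleton x)

/-! ### The law of the mark of a base station -/

namespace Params

variable (p : Params)

/-- Law of the position, beam direction and fading of a BS. -/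
noncomputable def markLaw : Measure (ℂ × ℝ × ℝ) :=
  ((volume : Measure ℂ)[|p.region]).prod (beamLaw.prod p.fadingLaw)

/-- Power received at the origin from a randomly directed BS with the given mark. -/
noncomputable def markPower (y : ℂ × ℝ × ℝ) : ℝ := p.meanPower ‖y.1‖ * p.G y.2.1 * y.2.2

theorem measurable_meanPower : Measurable p.meanPower := by
  unfold meanPower
  fun_prop

@[fun_prop]
theorem measurable_markPower : Measurable p.markPower := by
  unfold markPower
  have h1 : Measurable fun y : ℂ × ℝ × ℝ => p.meanPower ‖y.1‖ :=
    p.measurable_meanPower.comp (by fun_prop)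
  have h2 : Measurable fun y : ℂ × ℝ × ℝ => p.G y.2.1 := p.measurable_G.comp (by fun_prop)
  exact (h1.mul h2).mul (by fun_prop)

theorem measurableSet_region : MeasurableSet p.region :=
  (measurableSet_lt measurable_const measurable_norm).inter
    (measurableSet_lt measurable_norm measurable_const)

theorem area_pos : 0 < Real.pi * (p.tau ^ 2 - p.re ^ 2) := by
  have h0 := p.re_nonneg
  have h1 := p.re_lt_tau
  have : 0 < p.tau ^ 2 - p.re ^ 2 := by nlinarith
  have := Real.pi_pos
  positivity

theorem volume_region :
    volume p.region = ENNReal.ofReal (Real.pi * (p.tau ^ 2 - p.re ^ 2)) := by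
  have h0 := p.re_nonneg
  have h1 := p.re_lt_tau
  have e : p.region = Metric.ball (0 : ℂ) p.tau \ Metric.closedBall 0 p.re := by
    ext x
    simp [region, and_comm]
  have hsub : Metric.closedBall (0 : ℂ) p.re ⊆ Metric.ball 0 p.tau :=
    Metric.closedBall_subset_ball h1
  rw [e, measure_sdiff hsub measurableSet_closedBall.nullMeasurableSet
    (measure_closedBall_lt_top).ne, Complex.volume_ball, Complex.volume_closedBall]
  have hpi : (NNReal.pi : ℝ≥0∞) = ENNReal.ofReal Real.pi := by
    rw [← NNReal.coe_real_pi, ENNReal.ofReal_coe_nnreal]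
  rw [hpi, ← ENNReal.ofReal_pow (by linarith), ← ENNReal.ofReal_pow h0,
    ← ENNReal.ofReal_mul (by positivity), ← ENNReal.ofReal_mul (by positivity),
    ← ENNReal.ofReal_sub _ (by positivity)]
  congr 1
  ring

instance isProbabilityMeasure_cond_region :
    IsProbabilityMeasure ((volume : Measure ℂ)[|p.region]) :=
  cond_isProbabilityMeasure_of_finite
    (by rw [volume_region]; simpa using p.area_pos) (by rw [volume_region]; simp)

instance isProbabilityMeasure_beamLaw : IsProbabilityMeasure beamLaw :=
  cond_isProbabilityMeasure_of_finite
    (by simp [Real.pi_pos]) (by simp)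

instance isProbabilityMeasure_fadingLaw : IsProbabilityMeasure p.fadingLaw :=
  isProbabilityMeasure_gammaMeasure p.m_pos p.m_pos

instance isProbabilityMeasure_markLaw : IsProbabilityMeasure p.markLaw := by
  unfold markLaw
  infer_instance

/-- Circles are Lebesgue null; this excludes ties for the nearest BS. -/
theorem markLaw_norm_eq (r : ℝ) : p.markLaw {y | ‖y.1‖ = r} = 0 := by
  have e : {y : ℂ × ℝ × ℝ | ‖y.1‖ = r} = Metric.sphere (0 : ℂ) r ×ˢ univ := by
    ext y; simp
  rw [e, markLaw, Measure.prod_prod]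
  rw [cond_absolutelyContinuous (Measure.addHaar_sphere _ _ _), zero_mul]

end Params

/-! ### Joint law of the number of base stations and of their marks -/

namespace Network

variable {p : Params} {Ω : Type*} [MeasurableSpace Ω] {μ : Measure Ω} (S : Network p μ)

/-- Mark of the `i`-th BS. -/
def mark (i : ℕ) (ω : Ω) : ℂ × ℝ × ℝ := (S.X i ω, S.ξ i ω, S.H i ω)

/-- The sequence of all marks. -/
def marks (ω : Ω) (i : ℕ) : ℂ × ℝ × ℝ := S.mark i ω

theorem measurable_mark (i : ℕ) : Measurable (S.mark i) :=
  (S.measurable_X i).prodMk ((S.measurable_ξ i).prodMk (S.measurable_H i))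

theorem measurable_marks : Measurable S.marks := measurable_pi_lambda _ S.measurable_mark

theorem map_mark_eq (i : ℕ) : μ.map (S.mark i) = p.markLaw := S.map_mark i

/-- Independent identically distributed marks are exchangeable: both laws are the same infinite
product. -/
theorem map_marks_perm [IsProbabilityMeasure μ] (σ : Equiv.Perm ℕ) :
    μ.map (fun ω i => S.mark (σ i) ω) = μ.map S.marks := by
  have h1 : iIndepFun (fun i => S.mark (σ i)) μ := S.iIndepFun_mark.precomp σ.injective
  rw [h1.map_fun_eq_infinitePi_map fun i => S.measurable_mark _]
  have h2 : iIndepFun S.mark μ := S.iIndepFun_mark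
  change _ = μ.map (fun ω i => S.mark i ω)
  rw [h2.map_fun_eq_infinitePi_map S.measurable_mark]
  simp only [S.map_mark_eq]

theorem map_N_marks [IsProbabilityMeasure μ] :
    μ.map (fun ω => (S.N ω, S.marks ω)) = (poissonMeasure p.meanCount).prod (μ.map S.marks) := by
  have h : IndepFun S.N S.marks μ := S.indepFun_N
  rw [(indepFun_iff_map_prod_eq_prod_map_map S.measurable_N.aemeasurable
    S.measurable_marks.aemeasurable).1 h, S.map_N]

theorem lintegral_N_marks [IsProbabilityMeasure μ] {f : ℕ → (ℕ → ℂ × ℝ × ℝ) → ℝ≥0∞}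
    (hf : ∀ n, Measurable (f n)) :
    ∫⁻ ω, f (S.N ω) (S.marks ω) ∂μ =
      ∑' n, poissonMeasure p.meanCount {n} * ∫⁻ ω, f n (S.marks ω) ∂μ := by
  have hm : Measurable (fun z : ℕ × (ℕ → ℂ × ℝ × ℝ) => f z.1 z.2) :=
    measurable_from_prod_countable_right hf
  have h := lintegral_map (μ := μ) hm (S.measurable_N.prodMk S.measurable_marks)
  have := Measure.isProbabilityMeasure_map (μ := μ) S.measurable_marks.aemeasurable
  rw [← h, S.map_N_marks, lintegral_prod _ hm.aemeasurable, lintegral_countable']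
  refine tsum_congr fun n => ?_
  rw [mul_comm, lintegral_map (hf n) S.measurable_marks]

theorem measurable_from_N_marks {β : Type*} [MeasurableSpace β] {f : ℕ → (ℕ → ℂ × ℝ × ℝ) → β}
    (hf : ∀ n, Measurable (f n)) : Measurable fun ω => f (S.N ω) (S.marks ω) :=
  (measurable_from_prod_countable_right (f := fun z : ℕ × (ℕ → ℂ × ℝ × ℝ) => f z.1 z.2) hf).comp
    (S.measurable_N.prodMk S.measurable_marks)

theorem randomBeamPower_eq (i : ℕ) : S.randomBeamPower i = p.markPower ∘ S.mark i := by
  funext ω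
  simp only [randomBeamPower, Params.markPower, mark, Function.comp]

theorem measurable_randomBeamPower (i : ℕ) : Measurable (S.randomBeamPower i) := by
  rw [randomBeamPower_eq]
  exact p.measurable_markPower.comp (S.measurable_mark i)

theorem emfeRandom_eq (ω : Ω) :
    S.emfeRandom ω = ∑ k ∈ Finset.range (S.N ω), p.markPower (S.marks ω k) := by
  simp only [emfeRandom, randomBeamPower_eq, Function.comp, marks]

theorem measurable_emfeRandom : Measurable S.emfeRandom := by
  have h : Measurable (fun z : ℕ × Ω => ∑ i ∈ Finset.range z.1, S.randomBeamPower i z.2) := by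
    refine measurable_from_prod_countable_right fun n => ?_
    change Measurable fun ω => ∑ i ∈ Finset.range n, S.randomBeamPower i ω
    exact Finset.measurable_fun_sum _ fun i _ => S.measurable_randomBeamPower i
  have h2 := h.comp (S.measurable_N.prodMk measurable_id)
  unfold emfeRandom
  exact h2

/-- The event that no BS is located within the closed disk of radius `r`. -/
def clear (r : ℝ) : Set Ω := {ω | ∀ k < S.N ω, r < ‖S.X k ω‖}

theorem measurableSet_clear_prod :
    MeasurableSet {z : ℝ × Ω | z.2 ∈ S.clear z.1} := by
  have e : {z : ℝ × Ω | z.2 ∈ S.clear z.1} =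
      ⋂ k, ({z | k < S.N z.2}ᶜ ∪ {z | z.1 < ‖S.X k z.2‖}) := by
    ext z; simp [clear, imp_iff_not_or]
  rw [e]
  refine MeasurableSet.iInter fun k => ?_
  have hk : MeasurableSet {z : ℝ × Ω | k < S.N z.2} :=
    measurableSet_lt measurable_const (S.measurable_N.comp measurable_snd)
  have hX : MeasurableSet {z : ℝ × Ω | z.1 < ‖S.X k z.2‖} :=
    measurableSet_lt measurable_fst (((S.measurable_X k).comp measurable_snd).norm)
  exact hk.compl.union hX

theorem measurableSet_clear (r : ℝ) : MeasurableSet (S.clear r) :=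
  S.measurableSet_clear_prod.preimage (measurable_const.prodMk measurable_id)

/-! ### The serving base station -/

theorem exists_nearest {ω : Ω} (h : 0 < S.N ω) :
    ∃ i, i < S.N ω ∧ ∀ k < S.N ω, ‖S.X i ω‖ ≤ ‖S.X k ω‖ := by
  obtain ⟨i, hi, hi'⟩ := Finset.exists_min_image (Finset.range (S.N ω)) (fun i => ‖S.X i ω‖)
    ⟨0, by simpa using h⟩
  exact ⟨i, by simpa using hi, fun k hk => hi' k (by simpa using hk)⟩

theorem serving_spec {ω : Ω} (h : 0 < S.N ω) :
    S.serving ω < S.N ω ∧ ∀ k < S.N ω, ‖S.X (S.serving ω) ω‖ ≤ ‖S.X k ω‖ :=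
  Nat.sInf_mem (S.exists_nearest h)

/-- No two BSs are at the same distance from the origin. -/
theorem ae_norm_ne [IsProbabilityMeasure μ] :
    ∀ᵐ ω ∂μ, ∀ i k, i ≠ k → ‖S.X i ω‖ ≠ ‖S.X k ω‖ := by
  rw [ae_all_iff]; intro i
  rw [ae_all_iff]; intro k
  by_cases hik : i = k
  · simp [hik]
  have hind : IndepFun (S.mark i) (S.mark k) μ := S.iIndepFun_mark.indepFun hik
  have hlaw := (indepFun_iff_map_prod_eq_prod_map_map (S.measurable_mark i).aemeasurable
    (S.measurable_mark k).aemeasurable).1 hind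
  have hs : MeasurableSet {z : (ℂ × ℝ × ℝ) × (ℂ × ℝ × ℝ) | ‖z.1.1‖ = ‖z.2.1‖} :=
    measurableSet_eq_fun (by fun_prop) (by fun_prop)
  have h0 : μ.map (fun ω => (S.mark i ω, S.mark k ω)) {z | ‖z.1.1‖ = ‖z.2.1‖} = 0 := by
    -- With one mark fixed, the other BS would have to lie on a null circle.
    rw [hlaw, S.map_mark_eq, S.map_mark_eq, Measure.measure_prod_null hs]
    refine Eventually.of_forall fun y => ?_
    simpa [eq_comm] using p.markLaw_norm_eq ‖y.1‖
  rw [Measure.map_apply ((S.measurable_mark i).prodMk (S.measurable_mark k)) hs] at h0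
  filter_upwards [measure_eq_zero_iff_ae_notMem.1 h0] with ω hω _ using hω

theorem measurableSet_serving_eq (j : ℕ) : MeasurableSet {ω | S.serving ω = j} := by
  have hP : ∀ i, MeasurableSet {ω | i < S.N ω ∧ ∀ k < S.N ω, ‖S.X i ω‖ ≤ ‖S.X k ω‖} := by
    intro i
    have := S.measurable_from_N_marks (f := fun n m => i < n ∧ ∀ k < n, ‖(m i).1‖ ≤ ‖(m k).1‖)
      fun n => by
        refine measurable_const.and (Measurable.forall fun k => measurable_const.imp ?_)
        exact measurableSet_setOfPred.1 (measurableSet_le (by fun_prop) (by fun_prop))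
    exact measurableSet_setOfPred.2 this
  by_cases hj : ∃ ω, S.serving ω = j
  -- Without any BS the index is `sInf ∅ = 0`; otherwise it is the least minimizing index.
  · have e : {ω | S.serving ω = j} =
        ({ω | S.N ω = 0} ∩ {_ω | j = 0}) ∪
        ({ω | j < S.N ω ∧ ∀ k < S.N ω, ‖S.X j ω‖ ≤ ‖S.X k ω‖} ∩
          ⋂ i, ⋂ (_ : i < j), {ω | i < S.N ω ∧ ∀ k < S.N ω, ‖S.X i ω‖ ≤ ‖S.X k ω‖}ᶜ) := by
      ext ω
      simp only [mem_ofPred_eq, mem_union, mem_inter_iff, mem_iInter, mem_compl_iff]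
      constructor
      · rintro rfl
        rcases Nat.eq_zero_or_pos (S.N ω) with h | h
        · left; simp [h, serving]
        · exact Or.inr ⟨S.serving_spec h, fun i hi => Nat.notMem_of_lt_sInf hi⟩
      · rintro (⟨h, rfl⟩ | ⟨h, h'⟩)
        · simp [h, serving]
        · refine le_antisymm (Nat.sInf_le h) ?_
          by_contra! hlt
          exact h' _ hlt (S.serving_spec (by omega))
    rw [e]
    exact ((S.measurable_N (measurableSet_singleton 0)).inter (.const _)).union
      ((hP j).inter (MeasurableSet.iInter fun i => MeasurableSet.iInter fun _ => (hP i).compl))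
  · have : {ω | S.serving ω = j} = ∅ := by
      ext ω; simpa using fun h => hj ⟨ω, h⟩
    simp [this]

theorem measurable_serving : Measurable S.serving :=
  measurable_to_countable' fun j => S.measurableSet_serving_eq j

/-- Mark of the serving BS. -/
noncomputable def servingMark (ω : Ω) : ℂ × ℝ × ℝ := S.mark (S.serving ω) ω

theorem measurable_servingMark : Measurable S.servingMark :=
  (measurable_from_prod_countable_right (f := fun z : ℕ × Ω => S.mark z.1 z.2)
    S.measurable_mark).comp (S.measurable_serving.prodMk measurable_id)

theorem measurable_X₀ : Measurable S.X₀ := measurable_fst.comp S.measurable_servingMark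

theorem measurable_interference : Measurable S.interference := by
  have h : Measurable (fun z : (ℕ × ℕ) × Ω =>
      ∑ i ∈ (Finset.range z.1.1).erase z.1.2, S.randomBeamPower i z.2) := by
    refine measurable_from_prod_countable_right fun n => ?_
    change Measurable fun ω => ∑ i ∈ (Finset.range n.1).erase n.2, S.randomBeamPower i ω
    exact Finset.measurable_fun_sum _ fun i _ => S.measurable_randomBeamPower i
  have h2 : Measurable fun ω => ((S.N ω, S.serving ω), ω) :=
    (S.measurable_N.prodMk S.measurable_serving).prodMk measurable_id
  have h3 := h.comp h2
  unfold interference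
  exact h3

/-! ### The Mecke formula for the nearest point -/

/-- Indicator that the points indexed by `s` are at distance larger than that of `y`, times a
function of `y` and of the total power from these points. -/
noncomputable def peeled (p : Params) (F : (ℂ × ℝ × ℝ) × ℝ → ℝ≥0∞) (s : Finset ℕ)
    (y : ℂ × ℝ × ℝ) (m : ℕ → ℂ × ℝ × ℝ) : ℝ≥0∞ :=
  {z : (ℂ × ℝ × ℝ) × (ℕ → ℂ × ℝ × ℝ) | ∀ k ∈ s, ‖z.1.1‖ < ‖(z.2 k).1‖}.indicator
    (fun z => F (z.1, ∑ k ∈ s, p.markPower (z.2 k))) (y, m)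

theorem measurable_peeled {F : (ℂ × ℝ × ℝ) × ℝ → ℝ≥0∞} (hF : Measurable F) (s : Finset ℕ) :
    Measurable fun z : (ℂ × ℝ × ℝ) × (ℕ → ℂ × ℝ × ℝ) => peeled p F s z.1 z.2 := by
  refine Measurable.indicator (hF.comp (by fun_prop)) ?_
  rw [measurableSet_setOfPred]
  refine Measurable.forall fun k => measurable_const.imp ?_
  exact measurableSet_setOfPred.1 (measurableSet_lt (by fun_prop) (by fun_prop))

theorem measurable_peeled_right {F : (ℂ × ℝ × ℝ) × ℝ → ℝ≥0∞} (hF : Measurable F) (s : Finset ℕ)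
    (y : ℂ × ℝ × ℝ) : Measurable (peeled p F s y) :=
  (measurable_peeled hF s).comp measurable_prodMk_left

theorem measurable_peeled_eval {F : (ℂ × ℝ × ℝ) × ℝ → ℝ≥0∞} (hF : Measurable F) (s : Finset ℕ)
    (i : ℕ) : Measurable fun m => peeled p F s (m i) m := by
  have h := (measurable_peeled (p := p) hF s).comp
    ((measurable_pi_apply (X := fun _ : ℕ => ℂ × ℝ × ℝ) i).prodMk measurable_id)
  exact h

theorem measurable_lintegral_peeled [SFinite μ] {F : (ℂ × ℝ × ℝ) × ℝ → ℝ≥0∞} (hF : Measurable F)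
    (s : Finset ℕ) : Measurable fun y => ∫⁻ ω, peeled p F s y (S.marks ω) ∂μ := by
  have h := (measurable_peeled (p := p) hF s).comp
    (measurable_fst.prodMk (S.measurable_marks.comp measurable_snd))
  exact h.lintegral_prod_right'

theorem peeled_congr {F : (ℂ × ℝ × ℝ) × ℝ → ℝ≥0∞} {s : Finset ℕ} {y : ℂ × ℝ × ℝ}
    {m m' : ℕ → ℂ × ℝ × ℝ} (h : ∀ k ∈ s, m k = m' k) : peeled p F s y m = peeled p F s y m' := by
  have h1 : ∑ k ∈ s, p.markPower (m k) = ∑ k ∈ s, p.markPower (m' k) :=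
    Finset.sum_congr rfl fun k hk => by rw [h k hk]
  have h2 : (∀ k ∈ s, ‖y.1‖ < ‖(m k).1‖) ↔ ∀ k ∈ s, ‖y.1‖ < ‖(m' k).1‖ :=
    forall₂_congr fun k hk => by rw [h k hk]
  simp only [peeled, indicator, mem_ofPred_eq, h1, h2]

/-- As `i ∉ s`, the mark of `i` is independent of the marks indexed by `s`, the only ones that
`peeled` reads; Fubini applies to their product law. -/
theorem lintegral_peeled_self [IsProbabilityMeasure μ] {F : (ℂ × ℝ × ℝ) × ℝ → ℝ≥0∞}
    (hF : Measurable F) {s : Finset ℕ} {i : ℕ} (hi : i ∉ s) :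
    ∫⁻ ω, peeled p F s (S.mark i ω) (S.marks ω) ∂μ =
      ∫⁻ y, ∫⁻ ω, peeled p F s y (S.marks ω) ∂μ ∂p.markLaw := by
  classical
  have hind := S.iIndepFun_mark.indepFun_finset {i} s (by simpa using hi) S.measurable_mark
  set tail : Ω → (s → ℂ × ℝ × ℝ) := fun ω k => S.mark k ω with htail
  have htm : Measurable tail := measurable_pi_lambda _ fun k => S.measurable_mark k
  have hind' : IndepFun (S.mark i) tail μ :=
    hind.comp (φ := fun f : ({i} : Finset ℕ) → ℂ × ℝ × ℝ => f ⟨i, by simp⟩) (ψ := id)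
      (by fun_prop) measurable_id
  have hlaw := (indepFun_iff_map_prod_eq_prod_map_map (S.measurable_mark i).aemeasurable
    htm.aemeasurable).1 hind'
  -- Coordinates outside `s` are never read, so they are filled with `0`.
  set ext : (s → ℂ × ℝ × ℝ) → (ℕ → ℂ × ℝ × ℝ) := fun f k => if h : k ∈ s then f ⟨k, h⟩ else 0
  have hext : Measurable ext := measurable_pi_lambda _ fun k => by
    by_cases h : k ∈ s
    · simp only [ext, h, dite_true]; fun_prop
    · simp only [ext, h, dite_false]; fun_prop
  have hpe : ∀ y ω, peeled p F s y (S.marks ω) = peeled p F s y (ext (tail ω)) := fun y ω =>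
    peeled_congr fun k hk => by simp [ext, hk, htail, marks]
  have hm : Measurable fun z : (ℂ × ℝ × ℝ) × (s → ℂ × ℝ × ℝ) => peeled p F s z.1 (ext z.2) :=
    (measurable_peeled hF s).comp (measurable_fst.prodMk (hext.comp measurable_snd))
  simp only [hpe]
  have := Measure.isProbabilityMeasure_map (μ := μ) htm.aemeasurable
  rw [← lintegral_map (μ := μ) hm ((S.measurable_mark i).prodMk htm), hlaw, S.map_mark_eq,
    lintegral_prod _ hm.aemeasurable]
  refine lintegral_congr fun y => ?_
  exact lintegral_map (hm.comp measurable_prodMk_left) htm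

/-- The transposition of `i` and `n` carries `range n` onto `range (n + 1)` without `i`, and the
marks are exchangeable. -/
theorem lintegral_peeled_erase [IsProbabilityMeasure μ] {F : (ℂ × ℝ × ℝ) × ℝ → ℝ≥0∞}
    (hF : Measurable F) {n i : ℕ} (hi : i < n + 1) (y : ℂ × ℝ × ℝ) :
    ∫⁻ ω, peeled p F ((Finset.range (n + 1)).erase i) y (S.marks ω) ∂μ =
      ∫⁻ ω, peeled p F (Finset.range n) y (S.marks ω) ∂μ := by
  set σ : Equiv.Perm ℕ := Equiv.swap i n
  have hσ : (Finset.range n).map σ.toEmbedding = (Finset.range (n + 1)).erase i := by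
    ext k
    simp only [Finset.mem_map_equiv, Finset.mem_range, Finset.mem_erase, σ, Equiv.symm_swap,
      Equiv.swap_apply_def]
    split_ifs <;> omega
  have hpe : ∀ m : ℕ → ℂ × ℝ × ℝ, peeled p F ((Finset.range (n + 1)).erase i) y m =
      peeled p F (Finset.range n) y (fun k => m (σ k)) := by
    intro m
    simp only [peeled, ← hσ, indicator, mem_ofPred_eq, Finset.sum_map, Finset.forall_mem_map]
    rfl
  have hm : Measurable (peeled p F (Finset.range n) y) :=
    (measurable_peeled hF _).comp measurable_prodMk_left
  simp only [hpe]
  rw [← lintegral_map hm S.measurable_marks, ← S.map_marks_perm σ, lintegral_map hm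
    (measurable_pi_lambda _ fun i => S.measurable_mark _)]
  rfl

/-- Size-biasing a Poisson variable shifts it by one; hence the BSs other than the serving one are
again Poisson in number. -/
theorem poissonMeasure_succ (r : NNReal) (n : ℕ) :
    poissonMeasure r {n + 1} * (n + 1 : ℕ) = r * poissonMeasure r {n} := by
  rw [poissonMeasure_singleton, poissonMeasure_singleton, ← ENNReal.ofReal_coe_nnreal,
    ← ENNReal.ofReal_natCast, ← ENNReal.ofReal_mul (by positivity),
    ← ENNReal.ofReal_mul (by positivity)]
  congr 1
  rw [Nat.factorial_succ]
  push_cast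
  field_simp
  ring

/-- Almost surely a single index has all other BSs strictly farther, so the left integrand is a sum
over indices with one nonzero term. Given `N = n + 1`, the `n + 1` terms have the same mean `J n`,
and the factor `n + 1` is absorbed by `poissonMeasure_succ`. -/
theorem lintegral_servingMark_interference [IsProbabilityMeasure μ]
    {F : (ℂ × ℝ × ℝ) × ℝ → ℝ≥0∞} (hF : Measurable F) :
    ∫⁻ ω in {ω | 0 < S.N ω}, F (S.servingMark ω, S.interference ω) ∂μ =
      p.meanCount * ∫⁻ y, ∫⁻ ω in S.clear ‖y.1‖, F (y, S.emfeRandom ω) ∂μ ∂p.markLaw := by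
  have hpos : MeasurableSet {ω | 0 < S.N ω} := measurableSet_lt measurable_const S.measurable_N
  set f : ℕ → (ℕ → ℂ × ℝ × ℝ) → ℝ≥0∞ := fun n m =>
    ∑ i ∈ Finset.range n, peeled p F ((Finset.range n).erase i) (m i) m
  have hp := fun s i => measurable_peeled_eval (p := p) hF s i
  have hf : ∀ n, Measurable (f n) := fun n => Finset.measurable_fun_sum _ fun i _ => hp _ _
  have h1 : ∫⁻ ω in {ω | 0 < S.N ω}, F (S.servingMark ω, S.interference ω) ∂μ =
      ∫⁻ ω, f (S.N ω) (S.marks ω) ∂μ := by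
    rw [← lintegral_indicator hpos]
    refine lintegral_congr_ae ?_
    filter_upwards [S.ae_norm_ne] with ω hω
    rcases Nat.eq_zero_or_pos (S.N ω) with h | h
    · simp [h, f]
    have hsp := S.serving_spec h
    rw [indicator_of_mem (show ω ∈ {ω | 0 < S.N ω} from h)]
    simp only [f]
    -- Any other index fails because the serving BS is at most as far.
    rw [Finset.sum_eq_single_of_mem (S.serving ω) (by simpa using hsp.1)]
    · rw [peeled, indicator_of_mem]
      · rfl
      · intro k hk
        simp only [Finset.mem_erase, Finset.mem_range] at hk
        exact lt_of_le_of_ne (hsp.2 k hk.2) (hω _ _ hk.1.symm)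
    · intro i hi hne
      rw [peeled, indicator_of_notMem]
      simp only [mem_ofPred_eq, not_forall]
      refine ⟨S.serving ω, by simpa [hne.symm] using hsp.1, ?_⟩
      exact not_lt.2 (hsp.2 i (by simpa using hi))
  set J : ℕ → ℝ≥0∞ := fun n =>
    ∫⁻ y, ∫⁻ ω, peeled p F (Finset.range n) y (S.marks ω) ∂μ ∂p.markLaw with hJ
  have h2 : ∀ n, ∫⁻ ω, f (n + 1) (S.marks ω) ∂μ = (n + 1 : ℕ) * J n := by
    intro n
    simp only [f]
    have hp' : ∀ i, Measurable fun ω =>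
        peeled p F ((Finset.range (n + 1)).erase i) (S.marks ω i) (S.marks ω) := fun i =>
      (hp _ i).comp S.measurable_marks
    rw [lintegral_finsetSum _ fun i _ => hp' i]
    have hterm : ∀ i ∈ Finset.range (n + 1),
        ∫⁻ ω, peeled p F ((Finset.range (n + 1)).erase i) (S.marks ω i) (S.marks ω) ∂μ = J n :=
      fun i hi => (S.lintegral_peeled_self hF (by simp)).trans
        (lintegral_congr fun y => S.lintegral_peeled_erase hF (by simpa using hi) y)
    rw [Finset.sum_congr rfl hterm]
    simp
  have h3 : ∀ y : ℂ × ℝ × ℝ, ∫⁻ ω in S.clear ‖y.1‖, F (y, S.emfeRandom ω) ∂μ =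
      ∑' n, poissonMeasure p.meanCount {n} *
        ∫⁻ ω, peeled p F (Finset.range n) y (S.marks ω) ∂μ := by
    intro y
    rw [← S.lintegral_N_marks fun n => measurable_peeled_right hF _ _,
      ← lintegral_indicator (S.measurableSet_clear _)]
    refine lintegral_congr fun ω => ?_
    simp only [peeled, indicator, clear, mem_ofPred_eq, Finset.mem_range, emfeRandom_eq]
    rfl
  -- The term `n = 0` is an empty sum; splitting it off allows the shift of index.
  rw [h1, S.lintegral_N_marks hf, tsum_eq_zero_add' ENNReal.summable]
  simp only [h2, h3, ← mul_assoc, poissonMeasure_succ]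
  rw [lintegral_tsum fun n => ((S.measurable_lintegral_peeled hF _).const_mul _).aemeasurable]
  simp only [mul_assoc]
  rw [ENNReal.tsum_mul_left]
  simp only [f, Finset.range_zero, Finset.sum_empty, lintegral_zero, mul_zero, zero_add]
  congr 1
  refine tsum_congr fun n => ?_
  rw [lintegral_const_mul _ (S.measurable_lintegral_peeled hF _)]

end Network

/-! ### Radial integration and the contribution of distant base stations -/

namespace Params

variable (p : Params)

theorem coe_meanCount : (p.meanCount : ℝ) = p.lam * (Real.pi * (p.tau ^ 2 - p.re ^ 2)) :=
  Real.coe_toNNReal _ (mul_pos p.lam_pos p.area_pos).le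

/-- Polar coordinates: the dimension times the area of the unit disk gives `2π`, and the `2` is
moved into the integral to match `etaI`. Since `re ≤ r`, the constraints reduce to `r < ‖x‖ < tau`.
-/
theorem integral_radial_region {r : ℝ} (hr : p.re ≤ r) (hr' : r ≤ p.tau) (g : ℝ → ℂ) :
    ∫ x, (Ioi r).indicator g ‖x‖ ∂((volume : Measure ℂ)[|p.region]) =
      ((Real.pi * (p.tau ^ 2 - p.re ^ 2) : ℝ) : ℂ)⁻¹ *
        (Real.pi * ∫ s in r..p.tau, 2 * g s * s) := by
  have h0 := p.re_nonneg
  rw [ProbabilityTheory.cond, integral_smul_measure, volume_region, ENNReal.toReal_inv,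
    ENNReal.toReal_ofReal p.area_pos.le, ← integral_indicator p.measurableSet_region]
  have e : (p.region.indicator fun x : ℂ => (Ioi r).indicator g ‖x‖) =
      fun x => (Ioo r p.tau).indicator g ‖x‖ := by
    ext x
    by_cases h1 : r < ‖x‖
    · by_cases h2 : ‖x‖ < p.tau
      · have : x ∈ p.region := ⟨hr.trans_lt h1, h2⟩
        simp [this, h1, h2]
      · have : x ∉ p.region := fun h => h2 h.2
        simp [this, h2]
    · simp [indicator, h1]
  have hball : (volume : Measure ℂ).real (Metric.ball 0 1) = Real.pi := by
    rw [measureReal_def, Complex.volume_ball]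
    simp
  rw [e, integral_fun_norm_addHaar volume ((Ioo r p.tau).indicator g), hball,
    Complex.finrank_real_complex]
  have e2 : ∫ y in Ioi (0 : ℝ), y ^ (2 - 1) • (Ioo r p.tau).indicator g y =
      ∫ s in r..p.tau, g s * s := by
    rw [intervalIntegral.integral_of_le hr', integral_Ioc_eq_integral_Ioo,
      ← integral_indicator measurableSet_Ioi, ← integral_indicator measurableSet_Ioo]
    congr 1
    ext y
    by_cases hy : y ∈ Ioo r p.tau
    · have : (0 : ℝ) < y := by linarith [hy.1]
      simp [hy, this, mul_comm]
    · simp [indicator, hy]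
  rw [e2]
  have e3 : ∫ s in r..p.tau, 2 * g s * s = 2 * ∫ s in r..p.tau, g s * s := by
    rw [← intervalIntegral.integral_const_mul]
    simp only [mul_assoc]
  rw [e3]
  simp only [nsmul_eq_mul, Complex.real_smul]
  push_cast
  ring

/-- Characteristic functional of the power received from a BS farther than `r`. -/
noncomputable def farCF (q r : ℝ) : ℂ :=
  ∫ y in {y : ℂ × ℝ × ℝ | r < ‖y.1‖}, Complex.exp (Complex.I * q * p.markPower y) ∂p.markLaw

theorem measurableSet_far (r : ℝ) : MeasurableSet {y : ℂ × ℝ × ℝ | r < ‖y.1‖} :=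
  measurableSet_lt measurable_const (by fun_prop)

theorem norm_cexp_I_mul (q t : ℝ) : ‖Complex.exp (Complex.I * q * t)‖ = 1 := by
  have : Complex.I * q * t = ((q * t : ℝ) : ℂ) * Complex.I := by push_cast; ring
  rw [this, Complex.norm_exp_ofReal_mul_I]

theorem farCF_eq {r : ℝ} (hr : p.re ≤ r) (hr' : r ≤ p.tau) (q : ℝ) :
    p.farCF q r = ((Real.pi * (p.tau ^ 2 - p.re ^ 2) : ℝ) : ℂ)⁻¹ *
      (Real.pi * ((p.tau : ℂ) ^ 2 - (r : ℂ) ^ 2 - p.etaI q r)) := by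
  have hm : Measurable fun y : ℂ × ℝ × ℝ => Complex.exp (Complex.I * q * p.markPower y) := by
    have := p.measurable_markPower
    fun_prop
  have hint : Integrable ({y : ℂ × ℝ × ℝ | r < ‖y.1‖}.indicator
      fun y => Complex.exp (Complex.I * q * p.markPower y)) p.markLaw := by
    refine Integrable.indicator ?_ (measurableSet_far r)
    exact Integrable.of_bound hm.aestronglyMeasurable 1
      (Eventually.of_forall fun y => (norm_cexp_I_mul _ _).le)
  unfold farCF
  rw [← integral_indicator (measurableSet_far r), markLaw]
  rw [markLaw] at hint
  rw [integral_prod_symm _ hint]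
  have e : ∀ w : ℝ × ℝ, ∫ x, {y : ℂ × ℝ × ℝ | r < ‖y.1‖}.indicator
      (fun y => Complex.exp (Complex.I * q * p.markPower y)) (x, w)
        ∂((volume : Measure ℂ)[|p.region]) =
      ((Real.pi * (p.tau ^ 2 - p.re ^ 2) : ℝ) : ℂ)⁻¹ * (Real.pi * ∫ s in r..p.tau,
        2 * Complex.exp (Complex.I * q * p.meanPower s * p.G w.1 * w.2) * (s : ℂ)) := by
    intro w
    rw [← p.integral_radial_region hr hr'
      (fun s => Complex.exp (Complex.I * q * p.meanPower s * p.G w.1 * w.2))]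
    congr 1
    ext x
    simp only [indicator, mem_ofPred_eq, mem_Ioi, markPower]
    push_cast
    simp only [mul_assoc]
  simp only [e]
  rw [integral_const_mul, integral_const_mul, etaI]
  ring

/-- At `q = 0`, `farCF` becomes the probability that a BS is farther than `r`; this case supplies
the void probabilities. -/
theorem etaI_zero {r : ℝ} : p.etaI 0 r = 0 := by
  have e : ∫ s in r..p.tau, (2 : ℂ) * (s : ℂ) = (p.tau : ℂ) ^ 2 - (r : ℂ) ^ 2 := by
    have h : ∫ s in r..p.tau, (2 : ℝ) * s = p.tau ^ 2 - r ^ 2 := by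
      rw [intervalIntegral.integral_const_mul, integral_id]; ring
    have h2 := congrArg (fun x : ℝ => (x : ℂ)) h
    simp only [← intervalIntegral.integral_ofReal] at h2
    push_cast at h2
    exact h2
  simp [etaI, e]

end Params

/-! ### Characteristic functional and void probabilities of the Poisson process -/

namespace Network

variable {p : Params} {Ω : Type*} [MeasurableSpace Ω] {μ : Measure Ω} (S : Network p μ)

theorem integral_N_marks [IsProbabilityMeasure μ] {f : ℕ → (ℕ → ℂ × ℝ × ℝ) → ℂ}
    (hf : ∀ n, Measurable (f n)) (hb : ∀ n m, ‖f n m‖ ≤ 1) :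
    ∫ ω, f (S.N ω) (S.marks ω) ∂μ =
      ∑' n : ℕ, (Real.exp (-p.meanCount) * p.meanCount ^ n / n.factorial) •
        ∫ ω, f n (S.marks ω) ∂μ := by
  have hm : Measurable (fun z : ℕ × (ℕ → ℂ × ℝ × ℝ) => f z.1 z.2) :=
    measurable_from_prod_countable_right hf
  have h := integral_map (μ := μ) (S.measurable_N.prodMk S.measurable_marks).aemeasurable
    hm.aestronglyMeasurable
  have := Measure.isProbabilityMeasure_map (μ := μ) S.measurable_marks.aemeasurable
  have hint : Integrable (fun z : ℕ × (ℕ → ℂ × ℝ × ℝ) => f z.1 z.2)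
      ((poissonMeasure p.meanCount).prod (μ.map S.marks)) :=
    Integrable.of_bound hm.aestronglyMeasurable 1 (Eventually.of_forall fun z => hb _ _)
  rw [← h, S.map_N_marks, integral_prod _ hint, integral_poissonMeasure]
  refine tsum_congr fun n => ?_
  rw [integral_map S.measurable_marks.aemeasurable (hf n).aestronglyMeasurable]

/-- The indicator of `clear r` times the exponential is a product over the BSs of one factor `g`
each. For `n` independent BSs its mean is `farCF ^ n`, and the Poisson weights sum these to an
exponential. -/
theorem setIntegral_clear_cexp [IsProbabilityMeasure μ] (q r : ℝ) :
    ∫ ω in S.clear r, Complex.exp (Complex.I * q * S.emfeRandom ω) ∂μ =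
      Complex.exp (p.meanCount * (p.farCF q r - 1)) := by
  set g : ℂ × ℝ × ℝ → ℂ := {y : ℂ × ℝ × ℝ | r < ‖y.1‖}.indicator
      fun y => Complex.exp (Complex.I * q * p.markPower y) with hg
  have hgm : Measurable g := by
    refine Measurable.indicator ?_ (Params.measurableSet_far r)
    have := p.measurable_markPower
    fun_prop
  have hg1 : ∀ y, ‖g y‖ ≤ 1 := fun y =>
    (norm_indicator_le_norm_self _ _).trans (Params.norm_cexp_I_mul _ _).le
  have hgint : ∀ i, ∫ ω, g (S.mark i ω) ∂μ = p.farCF q r := by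
    intro i
    rw [← integral_map (S.measurable_mark i).aemeasurable hgm.aestronglyMeasurable, S.map_mark_eq,
      hg, integral_indicator (Params.measurableSet_far r)]
    rfl
  have hprod : ∀ ω, (S.clear r).indicator
      (fun ω => Complex.exp (Complex.I * q * S.emfeRandom ω)) ω =
      ∏ k ∈ Finset.range (S.N ω), g (S.marks ω k) := by
    intro ω
    by_cases h : ω ∈ S.clear r
    · have h' : ∀ k ∈ Finset.range (S.N ω), g (S.marks ω k) =
          Complex.exp (Complex.I * q * p.markPower (S.marks ω k)) := fun k hk =>
        indicator_of_mem (show S.marks ω k ∈ {y : ℂ × ℝ × ℝ | r < ‖y.1‖} from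
          h k (by simpa using hk)) _
      rw [indicator_of_mem h, Finset.prod_congr rfl h', ← Complex.exp_sum, emfeRandom_eq]
      push_cast
      rw [Finset.mul_sum]
    · rw [indicator_of_notMem h]
      simp only [clear, mem_ofPred_eq, not_forall] at h
      obtain ⟨k, hk, hk'⟩ := h
      refine (Finset.prod_eq_zero (by simpa using hk) ?_).symm
      exact indicator_of_notMem (show S.marks ω k ∉ {y : ℂ × ℝ × ℝ | r < ‖y.1‖} from hk') _
  have hterm : ∀ n : ℕ, ∫ ω, ∏ k ∈ Finset.range n, g (S.marks ω k) ∂μ = p.farCF q r ^ n := by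
    intro n
    have hind : iIndepFun (fun (i : Fin n) => S.mark i) μ :=
      S.iIndepFun_mark.precomp Fin.val_injective
    have h1 := hind.integral_fun_prod_comp (f := fun _ => g)
      (fun i => (S.measurable_mark i).aemeasurable) (fun i => hgm.aestronglyMeasurable)
    simp only [hgint, Finset.prod_const, Finset.card_univ, Fintype.card_fin] at h1
    rw [← h1]
    congr 1
    ext ω
    exact Finset.prod_range (n := n) fun k => g (S.mark k ω)
  rw [← integral_indicator (S.measurableSet_clear r)]
  simp only [hprod]
  rw [S.integral_N_marks (f := fun n m => ∏ k ∈ Finset.range n, g (m k))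
    (fun n => Finset.measurable_fun_prod _ fun k _ => hgm.comp (measurable_pi_apply k))
    (fun n m => by
      rw [norm_prod]
      exact Finset.prod_le_one (fun _ _ => norm_nonneg _) fun _ _ => hg1 _)]
  simp only [hterm]
  have e : Complex.exp (p.meanCount * (p.farCF q r - 1)) =
      Complex.exp (-p.meanCount) * Complex.exp (p.meanCount * p.farCF q r) := by
    rw [← Complex.exp_add]; ring_nf
  have hs : ∀ z : ℂ, Complex.exp z = ∑' n : ℕ, z ^ n / n.factorial := fun z => by
    rw [Complex.exp_eq_exp_ℂ, NormedSpace.exp_eq_tsum_div]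
  rw [e, hs (p.meanCount * p.farCF q r), ← tsum_mul_left]
  refine tsum_congr fun n => ?_
  simp only [Complex.real_smul]
  push_cast
  rw [mul_pow]
  ring

theorem measureReal_clear [IsProbabilityMeasure μ] {r : ℝ} (hr : p.re ≤ r) (hr' : r ≤ p.tau) :
    μ.real (S.clear r) = Real.exp (-p.lam * Real.pi * (r ^ 2 - p.re ^ 2)) := by
  have h := S.setIntegral_clear_cexp 0 r
  simp only [Complex.ofReal_zero, mul_zero, zero_mul, Complex.exp_zero] at h
  rw [setIntegral_const, p.farCF_eq hr hr', p.etaI_zero, Complex.real_smul, mul_one] at h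
  have ha := p.area_pos.ne'
  have e : (p.meanCount : ℂ) * (((Real.pi * (p.tau ^ 2 - p.re ^ 2) : ℝ) : ℂ)⁻¹ *
      (Real.pi * ((p.tau : ℂ) ^ 2 - (r : ℂ) ^ 2 - 0)) - 1) =
      ((-p.lam * Real.pi * (r ^ 2 - p.re ^ 2) : ℝ) : ℂ) := by
    have : ((p.meanCount : ℝ) : ℂ) = (p.meanCount : ℂ) := rfl
    rw [← this, p.coe_meanCount]
    have ha' : ((Real.pi * (p.tau ^ 2 - p.re ^ 2) : ℝ) : ℂ) ≠ 0 := Complex.ofReal_ne_zero.2 ha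
    have : ((p.lam * (Real.pi * (p.tau ^ 2 - p.re ^ 2)) : ℝ) : ℂ) =
      p.lam * ((Real.pi * (p.tau ^ 2 - p.re ^ 2) : ℝ) : ℂ) := by push_cast; ring
    rw [this, mul_sub, mul_assoc, mul_inv_cancel_left₀ ha']
    push_cast
    ring
  rw [e, ← Complex.ofReal_exp] at h
  exact_mod_cast h

/-- There may be no BS at all. Positivity for every real `r` lets the conditioned laws form a Markov
kernel on all of `ℝ`. -/
theorem measure_clear_pos [IsProbabilityMeasure μ] (r : ℝ) : 0 < μ (S.clear r) := by
  have h0 : μ {ω | S.N ω = 0} ≠ 0 := by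
    have : μ {ω | S.N ω = 0} = poissonMeasure p.meanCount {0} := by
      rw [← S.map_N, Measure.map_apply S.measurable_N (measurableSet_singleton 0)]; rfl
    rw [this, poissonMeasure_singleton]
    simp [Real.exp_pos]
  exact (pos_iff_ne_zero.2 h0).trans_le (measure_mono fun ω (hω : S.N ω = 0) k hk => by omega)

instance isProbabilityMeasure_cond_clear [IsProbabilityMeasure μ] (r : ℝ) :
    IsProbabilityMeasure (μ[|S.clear r]) :=
  cond_isProbabilityMeasure (S.measure_clear_pos r).ne'

/-- Dividing by the value at `q = 0` leaves the exponent `Λ (farCF q r - farCF 0 r)`, with `Λ` the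
mean count, which equals `-π λ etaI`. -/
theorem integral_cond_clear_cexp [IsProbabilityMeasure μ] {r : ℝ} (hr : p.re ≤ r)
    (hr' : r ≤ p.tau) (q : ℝ) :
    ∫ ω, Complex.exp (Complex.I * q * S.emfeRandom ω) ∂μ[|S.clear r] =
      p.cfInterference q r := by
  rw [ProbabilityTheory.cond, integral_smul_measure, S.setIntegral_clear_cexp, ENNReal.toReal_inv,
    ← measureReal_def]
  have h := S.setIntegral_clear_cexp 0 r
  simp only [Complex.ofReal_zero, mul_zero, zero_mul, Complex.exp_zero] at h
  rw [setIntegral_const, Complex.real_smul, mul_one] at h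
  rw [Complex.real_smul, Complex.ofReal_inv, h, ← Complex.exp_neg, ← Complex.exp_add,
    Params.cfInterference, p.farCF_eq hr hr', p.farCF_eq hr hr', p.etaI_zero]
  congr 1
  have ha' : ((Real.pi * (p.tau ^ 2 - p.re ^ 2) : ℝ) : ℂ) ≠ 0 :=
    Complex.ofReal_ne_zero.2 p.area_pos.ne'
  have h1 : ((p.meanCount : ℝ) : ℂ) = (p.meanCount : ℂ) := rfl
  have h2 : ((p.lam * (Real.pi * (p.tau ^ 2 - p.re ^ 2)) : ℝ) : ℂ) =
      p.lam * ((Real.pi * (p.tau ^ 2 - p.re ^ 2) : ℝ) : ℂ) := by push_cast; ring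
  rw [← h1, p.coe_meanCount, h2]
  field_simp
  ring

/-- No BS lies in the exclusion disk, so the random user is the case `r = re`. -/
theorem cond_clear_re [IsProbabilityMeasure μ] : μ[|S.clear p.re] = μ := by
  have h : μ (S.clear p.re) = 1 := by
    have := S.measureReal_clear le_rfl p.re_lt_tau.le
    rw [sub_self, mul_zero, Real.exp_zero, measureReal_def] at this
    exact (ENNReal.toReal_eq_one_iff _).1 this
  rw [ProbabilityTheory.cond, h, inv_one, one_smul, Measure.restrict_eq_self_of_ae_mem]
  exact (mem_ae_iff_prob_eq_one (S.measurableSet_clear _)).2 h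

theorem integral_cexp_emfeRandom [IsProbabilityMeasure μ] (q : ℝ) :
    ∫ ω, Complex.exp (Complex.I * q * S.emfeRandom ω) ∂μ = p.cfInterference q p.re := by
  rw [← S.integral_cond_clear_cexp le_rfl p.re_lt_tau.le, S.cond_clear_re]

end Network

/-! ### Conditional integrals and the uniform angle -/

theorem lintegral_cond_eq {α : Type*} [MeasurableSpace α] (μ : Measure α) (s : Set α)
    (f : α → ℝ≥0∞) : ∫⁻ x, f x ∂μ[|s] = (μ s)⁻¹ * ∫⁻ x in s, f x ∂μ := by
  rw [ProbabilityTheory.cond, lintegral_smul_measure, smul_eq_mul]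

theorem setLIntegral_eq_mul_lintegral_cond {α : Type*} [MeasurableSpace α] (μ : Measure α)
    [IsFiniteMeasure μ] {s : Set α} (hs : μ s ≠ 0) (f : α → ℝ≥0∞) :
    ∫⁻ x in s, f x ∂μ = μ s * ∫⁻ x, f x ∂μ[|s] := by
  rw [lintegral_cond_eq, ← mul_assoc, ENNReal.mul_inv_cancel hs (measure_ne_top _ _), one_mul]

/-- Uniform law of the angle of a BS. -/
noncomputable def angleLaw : Measure ℝ := (volume : Measure ℝ)[|Ioc 0 (2 * Real.pi)]

theorem volume_angle : volume (Ioc 0 (2 * Real.pi)) = ENNReal.ofReal (2 * Real.pi) := by simp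

instance isProbabilityMeasure_angleLaw : IsProbabilityMeasure angleLaw :=
  cond_isProbabilityMeasure_of_finite (by rw [volume_angle]; simp [Real.pi_pos])
    (by rw [volume_angle]; exact ENNReal.ofReal_ne_top)

/-- The point with polar coordinates `(r, θ)`. -/
noncomputable def polarPoint (r θ : ℝ) : ℂ := r * Complex.exp (Complex.I * θ)

theorem measurable_polarPoint : Measurable fun z : ℝ × ℝ => polarPoint z.1 z.2 := by
  unfold polarPoint
  fun_prop

theorem norm_polarPoint (r θ : ℝ) : ‖polarPoint r θ‖ = |r| := by
  rw [polarPoint, norm_mul, mul_comm Complex.I, Complex.norm_exp_ofReal_mul_I, mul_one,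
    Complex.norm_real, Real.norm_eq_abs]

theorem polarPoint_eq_polarCoord_symm (z : ℝ × ℝ) :
    Complex.polarCoord.symm z = polarPoint z.1 z.2 := by
  rw [Complex.polarCoord_symm_apply, polarPoint, mul_comm Complex.I, Complex.exp_mul_I]
  push_cast
  rfl

/-- By periodicity, the range `(-π, π)` of polar coordinates can be replaced by the range `(0, 2π]`
of the averaged formula. -/
theorem setLIntegral_polarPoint_eq (r : ℝ) (g : ℂ → ℝ≥0∞) :
    ∫⁻ θ in Ioo (-Real.pi) Real.pi, g (polarPoint r θ) =
      ENNReal.ofReal (2 * Real.pi) * ∫⁻ θ, g (polarPoint r θ) ∂angleLaw := by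
  have : Fact (0 < 2 * Real.pi) := ⟨by positivity⟩
  have hper : Function.Periodic (fun θ => g (polarPoint r θ)) (2 * Real.pi) := by
    intro θ
    simp only [polarPoint]
    congr 2
    push_cast
    rw [mul_add, Complex.exp_add, mul_comm Complex.I (2 * Real.pi), Complex.exp_two_pi_mul_I,
      mul_one]
  have h1 := AddCircle.lintegral_preimage (2 * Real.pi) (-Real.pi) hper.lift
  have h2 := AddCircle.lintegral_preimage (2 * Real.pi) 0 hper.lift
  simp only [Function.Periodic.lift_coe] at h1 h2
  rw [zero_add, ← h1] at h2
  have e : -Real.pi + 2 * Real.pi = Real.pi := by ring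
  rw [e, ← setLIntegral_congr (Ioo_ae_eq_Ioc (a := -Real.pi))] at h2
  have h0 : ENNReal.ofReal (2 * Real.pi) ≠ 0 := by simp [Real.pi_pos]
  rw [angleLaw, lintegral_cond_eq, ← h2, volume_angle, ← mul_assoc,
    ENNReal.mul_inv_cancel h0 ENNReal.ofReal_ne_top, one_mul]

theorem Params.measurable_servingDensity (p : Params) : Measurable p.servingDensity := by
  unfold Params.servingDensity
  exact Measurable.indicator (by fun_prop) measurableSet_Ioo

/-! ### Disintegration along the serving base station -/

namespace Network

variable {p : Params} {Ω : Type*} [MeasurableSpace Ω] {μ : Measure Ω} (S : Network p μ)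

theorem measurable_measure_clear_inter [IsProbabilityMeasure μ] {B : Set Ω}
    (hB : MeasurableSet B) : Measurable fun r => μ (S.clear r ∩ B) := by
  have h := measurable_measure_prodMk_left (ν := μ)
    (S.measurableSet_clear_prod.inter (hB.preimage measurable_snd))
  exact h

theorem measurable_measure_clear [IsProbabilityMeasure μ] :
    Measurable fun r => μ (S.clear r) := by
  simpa using S.measurable_measure_clear_inter MeasurableSet.univ

/-- Law of the network given that no BS is within distance `r`. -/
noncomputable def clearKernel [IsProbabilityMeasure μ] : Kernel ℝ Ω where
  toFun r := μ[|S.clear r]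
  measurable' := by
    refine Measure.measurable_of_measurable_coe _ fun B hB => ?_
    have h : (fun r => (μ[|S.clear r]) B) = fun r => (μ (S.clear r))⁻¹ * μ (S.clear r ∩ B) := by
      ext r
      exact cond_apply (S.measurableSet_clear r) μ B
    rw [h]
    exact S.measurable_measure_clear.inv.mul (S.measurable_measure_clear_inter hB)

theorem clearKernel_apply [IsProbabilityMeasure μ] (r : ℝ) :
    S.clearKernel r = μ[|S.clear r] := rfl

instance isMarkovKernel_clearKernel [IsProbabilityMeasure μ] : IsMarkovKernel S.clearKernel :=
  ⟨fun r => S.isProbabilityMeasure_cond_clear r⟩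

/-- Law of the interference at the origin given that no BS is within distance `r`. -/
noncomputable def interferenceKernel [IsProbabilityMeasure μ] : Kernel ℝ ℝ :=
  S.clearKernel.map S.emfeRandom

theorem interferenceKernel_apply [IsProbabilityMeasure μ] (r : ℝ) :
    S.interferenceKernel r = (μ[|S.clear r]).map S.emfeRandom := by
  rw [interferenceKernel, Kernel.map_apply _ S.measurable_emfeRandom, clearKernel_apply]

instance isMarkovKernel_interferenceKernel [IsProbabilityMeasure μ] :
    IsMarkovKernel S.interferenceKernel :=
  Kernel.IsMarkovKernel.map _ S.measurable_emfeRandom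

/-- Conditional law of the beam direction and fading of the serving BS, and of the interference,
given the distance to the serving BS. -/
noncomputable def condLaw [IsProbabilityMeasure μ] : Kernel ℝ ((ℝ × ℝ) × ℝ) :=
  (Kernel.const ℝ (Params.beamLaw.prod p.fadingLaw)) ×ₖ S.interferenceKernel

theorem condLaw_apply [IsProbabilityMeasure μ] (r : ℝ) :
    S.condLaw r = (Params.beamLaw.prod p.fadingLaw).prod (S.interferenceKernel r) := by
  rw [condLaw, Kernel.prod_apply, Kernel.const_apply]

instance isMarkovKernel_condLaw [IsProbabilityMeasure μ] : IsMarkovKernel S.condLaw := by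
  unfold condLaw
  infer_instance

/-- Beam direction and fading of the serving BS, and interference. -/
noncomputable def environment (ω : Ω) : (ℝ × ℝ) × ℝ := ((S.servingMark ω).2, S.interference ω)

theorem measurable_environment : Measurable S.environment :=
  (measurable_snd.comp S.measurable_servingMark).prodMk S.measurable_interference

theorem measure_pos_eq [IsProbabilityMeasure μ] :
    μ {ω | 0 < S.N ω} = ENNReal.ofReal (1 - Real.exp (-p.meanCount)) := by
  have h0 : μ {ω | S.N ω = 0} = ENNReal.ofReal (Real.exp (-p.meanCount)) := by
    have : μ {ω | S.N ω = 0} = poissonMeasure p.meanCount {0} := by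
      rw [← S.map_N, Measure.map_apply S.measurable_N (measurableSet_singleton 0)]; rfl
    rw [this, poissonMeasure_singleton]
    simp
  have e : {ω | 0 < S.N ω} = {ω | S.N ω = 0}ᶜ := by ext ω; simp [Nat.pos_iff_ne_zero]
  have hms : MeasurableSet {ω | S.N ω = 0} := S.measurable_N (measurableSet_singleton 0)
  rw [e, prob_compl_eq_one_sub hms, h0,
    ENNReal.ofReal_sub _ (Real.exp_pos _).le, ENNReal.ofReal_one]

theorem meanCount_pos (p : Params) : (0 : ℝ) < p.meanCount := by
  rw [p.coe_meanCount]
  exact mul_pos p.lam_pos p.area_pos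

theorem measure_pos_ne_zero [IsProbabilityMeasure μ] : μ {ω | 0 < S.N ω} ≠ 0 := by
  rw [S.measure_pos_eq]
  have := meanCount_pos p
  simpa using this

instance isProbabilityMeasure_served [IsProbabilityMeasure μ] : IsProbabilityMeasure S.served :=
  cond_isProbabilityMeasure S.measure_pos_ne_zero

/-- Density of the distance to the serving BS with respect to the law of a typical BS. -/
noncomputable def nearestWeight (r : ℝ) : ℝ≥0∞ :=
  (μ {ω | 0 < S.N ω})⁻¹ * p.meanCount * μ (S.clear r)

theorem measurable_nearestWeight [IsProbabilityMeasure μ] : Measurable S.nearestWeight :=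
  S.measurable_measure_clear.const_mul _

theorem measurable_nearestWeight_norm [IsProbabilityMeasure μ] :
    Measurable fun x : ℂ => S.nearestWeight ‖x‖ :=
  S.measurable_nearestWeight.comp measurable_norm

/-- In the nearest-point formula, the integral over `clear ‖x‖` is its probability times a
conditional mean. The probability goes into `nearestWeight`, the conditional mean into `condLaw`. -/
theorem lintegral_served [IsProbabilityMeasure μ] {F : ℂ × ((ℝ × ℝ) × ℝ) → ℝ≥0∞}
    (hF : Measurable F) :
    ∫⁻ ω, F (S.X₀ ω, S.environment ω) ∂S.served =
      ∫⁻ x, S.nearestWeight ‖x‖ * ∫⁻ v, F (x, v) ∂S.condLaw ‖x‖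
        ∂((volume : Measure ℂ)[|p.region]) := by
  set F' : (ℂ × ℝ × ℝ) × ℝ → ℝ≥0∞ := fun z => F (z.1.1, (z.1.2, z.2)) with hF'
  have hF'm : Measurable F' := hF.comp (by fun_prop)
  have h1 : ∀ ω, F (S.X₀ ω, S.environment ω) = F' (S.servingMark ω, S.interference ω) :=
    fun ω => rfl
  simp only [h1]
  rw [served, lintegral_cond_eq, S.lintegral_servingMark_interference hF'm]
  have h2 : ∀ y : ℂ × ℝ × ℝ, ∫⁻ ω in S.clear ‖y.1‖, F' (y, S.emfeRandom ω) ∂μ =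
      μ (S.clear ‖y.1‖) * ∫⁻ t, F' (y, t) ∂S.interferenceKernel ‖y.1‖ := by
    intro y
    rw [setLIntegral_eq_mul_lintegral_cond _ (S.measure_clear_pos _).ne',
      S.interferenceKernel_apply, lintegral_map (f := fun t => F' (y, t))
      (hF'm.comp measurable_prodMk_left) S.measurable_emfeRandom]
  simp only [h2]
  have hm : Measurable fun y : ℂ × ℝ × ℝ => ∫⁻ t, F' (y, t) ∂S.interferenceKernel ‖y.1‖ :=
    hF'm.lintegral_kernel_prod_right'
      (κ := S.interferenceKernel.comap (fun y : ℂ × ℝ × ℝ => ‖y.1‖) (by fun_prop))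
  have hc : Measurable fun x : ℂ => μ (S.clear ‖x‖) :=
    S.measurable_measure_clear.comp measurable_norm
  have hc' : Measurable fun y : ℂ × ℝ × ℝ => μ (S.clear ‖y.1‖) :=
    hc.comp measurable_fst
  have hmul : Measurable fun y : ℂ × ℝ × ℝ => μ (S.clear ‖y.1‖) *
      ∫⁻ t, F' (y, t) ∂S.interferenceKernel ‖y.1‖ := hc'.mul hm
  rw [Params.markLaw, lintegral_prod _ hmul.aemeasurable, ← mul_assoc,
    ← lintegral_const_mul _ (Measurable.lintegral_prod_right' hmul)]
  refine lintegral_congr fun x => ?_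
  have hm' : Measurable fun w : ℝ × ℝ => ∫⁻ t, F' ((x, w), t) ∂S.interferenceKernel ‖x‖ :=
    hm.comp measurable_prodMk_left
  have hF1 : Measurable fun v : (ℝ × ℝ) × ℝ => F (x, v) := hF.comp measurable_prodMk_left
  simp only
  rw [S.condLaw_apply, lintegral_prod _ hF1.aemeasurable, lintegral_const_mul _ hm',
    nearestWeight, ← mul_assoc]

/-- Law of the position of the serving BS. -/
noncomputable def servingLaw : Measure ℂ :=
  ((volume : Measure ℂ)[|p.region]).withDensity fun x => S.nearestWeight ‖x‖

theorem map_X₀ [IsProbabilityMeasure μ] : S.served.map S.X₀ = S.servingLaw := by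
  refine Measure.ext_of_lintegral _ fun f hf => ?_
  rw [lintegral_map hf S.measurable_X₀, servingLaw, lintegral_withDensity_eq_lintegral_mul _
    S.measurable_nearestWeight_norm hf]
  have h := S.lintegral_served (F := fun z => f z.1) (hf.comp measurable_fst)
  simp only [lintegral_const, measure_univ, mul_one] at h
  exact h

theorem map_X₀_environment [IsProbabilityMeasure μ] :
    S.served.map (fun ω => (S.X₀ ω, S.environment ω)) =
      S.served.map S.X₀ ⊗ₘ S.condLaw.comap (fun x : ℂ => ‖x‖) measurable_norm := by
  have := Measure.isProbabilityMeasure_map (μ := S.served) S.measurable_X₀.aemeasurable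
  refine Measure.ext_of_lintegral _ fun F hF => ?_
  rw [lintegral_map hF (S.measurable_X₀.prodMk S.measurable_environment), S.lintegral_served hF,
    Measure.lintegral_compProd hF, S.map_X₀, servingLaw, lintegral_withDensity_eq_lintegral_mul _
    S.measurable_nearestWeight_norm]
  · rfl
  · exact hF.lintegral_kernel_prod_right'
      (κ := S.condLaw.comap (fun x : ℂ => ‖x‖) measurable_norm)

/-- Conditional characteristic functions are computed with the kernel `condLaw`. -/
theorem hasCondCF_of_condLaw [IsProbabilityMeasure μ] {y : ℂ × ((ℝ × ℝ) × ℝ) → ℝ}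
    (hy : Measurable y) {φ : ℝ → ℂ → ℂ}
    (hφ : ∀ q : ℝ, ∀ x ∈ p.region,
      ∫ v, Complex.exp (Complex.I * q * y (x, v)) ∂S.condLaw ‖x‖ = φ q x) :
    S.HasCondCF (fun ω => y (S.X₀ ω, S.environment ω)) φ := by
  intro q
  -- The factorization of the joint law identifies the regular conditional distribution, by
  -- uniqueness.
  have hcd := condDistrib_ae_eq_of_measure_eq_compProd (μ := S.served) S.X₀
    S.measurable_environment.aemeasurable S.map_X₀_environment
  have hf : Measurable fun z : ℂ × ((ℝ × ℝ) × ℝ) => Complex.exp (Complex.I * q * y z) := by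
    fun_prop
  have hce := condExp_prod_ae_eq_integral_condDistrib (μ := S.served) S.measurable_X₀
    S.measurable_environment.aemeasurable hf.stronglyMeasurable
    (Integrable.of_bound (hf.comp (S.measurable_X₀.prodMk
      S.measurable_environment)).aestronglyMeasurable 1
      (Eventually.of_forall fun ω => (Params.norm_cexp_I_mul _ _).le))
  have hreg : ∀ᵐ x ∂(S.served.map S.X₀), x ∈ p.region := by
    rw [S.map_X₀, servingLaw]
    refine (withDensity_absolutelyContinuous _ _).ae_le ?_
    exact ae_cond_mem p.measurableSet_region
  filter_upwards [hce, ae_of_ae_map S.measurable_X₀.aemeasurable hcd,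
    ae_of_ae_map S.measurable_X₀.aemeasurable hreg] with ω h1 h2 h3
  rw [h1, h2, Kernel.comap_apply, hφ q _ h3]

/-- The factors are the uniform density on the region, the Jacobian `r`, the weight and the angular
mass. Mean count over area is `λ`, and multiplying numerator and denominator by `e^{-λπ re²}` gives
the stated form. -/
theorem mul_nearestWeight [IsProbabilityMeasure μ] {r : ℝ} (hr : r ∈ Ioo p.re p.tau) :
    (volume p.region)⁻¹ * ENNReal.ofReal r * S.nearestWeight r * ENNReal.ofReal (2 * Real.pi) =
      ENNReal.ofReal (p.servingDensity r) := by
  have h0 : 0 < r := p.re_nonneg.trans_lt hr.1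
  have hc : μ (S.clear r) = ENNReal.ofReal (Real.exp (-p.lam * Real.pi * (r ^ 2 - p.re ^ 2))) := by
    rw [← S.measureReal_clear hr.1.le hr.2.le, ofReal_measureReal]
  have hL := meanCount_pos p
  have hpos : 0 < 1 - Real.exp (-p.meanCount) := by simpa using hL
  have ha := p.area_pos
  rw [nearestWeight, hc, S.measure_pos_eq, p.volume_region, ← ENNReal.ofReal_inv_of_pos hpos,
    ← ENNReal.ofReal_inv_of_pos ha, ← ENNReal.ofReal_coe_nnreal, ← ENNReal.ofReal_mul (by positivity),
    ← ENNReal.ofReal_mul (by positivity), ← ENNReal.ofReal_mul (by positivity),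
    ← ENNReal.ofReal_mul (by positivity), ← ENNReal.ofReal_mul (by positivity),
    Params.servingDensity, indicator_of_mem hr]
  congr 1
  rw [p.coe_meanCount] at hpos ⊢
  have e1 : Real.exp (-p.lam * Real.pi * (r ^ 2 - p.re ^ 2)) =
      Real.exp (-p.lam * Real.pi * r ^ 2) / Real.exp (-p.lam * Real.pi * p.re ^ 2) := by
    rw [← Real.exp_sub]; ring_nf
  have e2 : Real.exp (-p.lam * Real.pi * p.re ^ 2) - Real.exp (-p.lam * Real.pi * p.tau ^ 2) =
      Real.exp (-p.lam * Real.pi * p.re ^ 2) *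
        (1 - Real.exp (-(p.lam * (Real.pi * (p.tau ^ 2 - p.re ^ 2))))) := by
    rw [mul_sub, ← Real.exp_add]; ring_nf
  rw [e1, e2]
  have h3 : p.tau ^ 2 - p.re ^ 2 ≠ 0 := fun h => by simp [h] at ha
  field_simp

theorem lintegral_servingLaw [IsProbabilityMeasure μ] {g : ℂ → ℝ≥0∞} (hg : Measurable g) :
    ∫⁻ x, g x ∂S.servingLaw =
      ∫⁻ r, ENNReal.ofReal (p.servingDensity r) * ∫⁻ θ, g (polarPoint r θ) ∂angleLaw := by
  have hn := S.measurable_nearestWeight_norm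
  rw [servingLaw, lintegral_withDensity_eq_lintegral_mul _ hn hg, lintegral_cond_eq,
    ← lintegral_indicator p.measurableSet_region, ← Complex.lintegral_comp_polarCoord_symm,
    polarCoord_target, Measure.volume_eq_prod]
  simp only [polarPoint_eq_polarCoord_symm]
  set f : ℂ → ℝ≥0∞ := p.region.indicator ((fun x => S.nearestWeight ‖x‖) * g) with hf
  have hfm : Measurable f := (hn.mul hg).indicator p.measurableSet_region
  have hfm' : Measurable fun z : ℝ × ℝ => ENNReal.ofReal z.1 • f (polarPoint z.1 z.2) :=
    measurable_fst.ennreal_ofReal.smul (hfm.comp measurable_polarPoint)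
  rw [setLIntegral_prod _ hfm'.aemeasurable,
    ← lintegral_const_mul _ (Measurable.lintegral_prod_right' hfm'),
    ← lintegral_indicator measurableSet_Ioi]
  refine lintegral_congr fun r => ?_
  by_cases hr : r ∈ Ioo p.re p.tau
  · have h0 : 0 < r := p.re_nonneg.trans_lt hr.1
    have hfr : ∀ θ, f (polarPoint r θ) = S.nearestWeight r * g (polarPoint r θ) := by
      intro θ
      have hmem : polarPoint r θ ∈ p.region := by
        constructor <;> rw [norm_polarPoint, abs_of_pos h0]
        exacts [hr.1, hr.2]
      rw [hf, indicator_of_mem hmem, Pi.mul_apply, norm_polarPoint, abs_of_pos h0]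
    have hgm : Measurable fun θ => g (polarPoint r θ) :=
      hg.comp (measurable_polarPoint.comp measurable_prodMk_left)
    rw [indicator_of_mem (show r ∈ Ioi 0 from h0), ← S.mul_nearestWeight hr]
    simp only [hfr, smul_eq_mul]
    rw [lintegral_const_mul _ (hgm.const_mul _), lintegral_const_mul _ hgm,
      setLIntegral_polarPoint_eq]
    ring
  · rw [Params.servingDensity, indicator_of_notMem hr, ENNReal.ofReal_zero, zero_mul]
    by_cases h0 : r ∈ Ioi 0
    · have hfr : ∀ θ, f (polarPoint r θ) = 0 := by
        intro θ
        rw [hf, indicator_of_notMem]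
        rintro ⟨h1, h2⟩
        rw [norm_polarPoint, abs_of_pos h0] at h1 h2
        exact hr ⟨h1, h2⟩
      simp [hfr]
    · rw [indicator_of_notMem h0]

theorem map_R₀ [IsProbabilityMeasure μ] :
    S.served.map S.R₀ = volume.withDensity fun r => ENNReal.ofReal (p.servingDensity r) := by
  have hR : Measurable S.R₀ := S.measurable_X₀.norm
  refine Measure.ext_of_lintegral _ fun f hf => ?_
  have h1 : ∫⁻ a, f a ∂(S.served.map S.R₀) = ∫⁻ x, f ‖x‖ ∂S.servingLaw := by
    rw [lintegral_map hf hR, ← S.map_X₀,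
      lintegral_map (f := fun x : ℂ => f ‖x‖) (hf.comp measurable_norm) S.measurable_X₀]
    rfl
  rw [h1, S.lintegral_servingLaw (g := fun x => f ‖x‖) (hf.comp measurable_norm),
    lintegral_withDensity_eq_lintegral_mul _ p.measurable_servingDensity.ennreal_ofReal hf]
  refine lintegral_congr fun r => ?_
  simp only [norm_polarPoint, lintegral_const, measure_univ, mul_one, Pi.mul_apply]
  by_cases hr : r ∈ Ioo p.re p.tau
  · rw [abs_of_pos (p.re_nonneg.trans_lt hr.1)]
  · rw [Params.servingDensity, indicator_of_notMem hr, ENNReal.ofReal_zero, zero_mul, zero_mul]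

end Network

/-! ### Bounds and absence of atoms for the power of one base station -/

namespace Params

variable (p : Params)

theorem kappa_pos : 0 < p.kappa := by
  have := p.freq_pos
  have := Real.pi_pos
  unfold kappa
  positivity

theorem meanPower_pos (r : ℝ) : 0 < p.meanPower r := by
  have := p.kappa_pos
  have := p.Pt_pos
  have := p.z_pos
  unfold meanPower
  positivity

theorem meanPower_le (r : ℝ) : p.meanPower r ≤ p.meanPower 0 := by
  have h1 := p.kappa_pos
  have h2 := p.Pt_pos
  have h3 := p.z_pos
  have h4 := p.two_lt_alpha
  unfold meanPower
  gcongr ?_ * (?_ * ?_)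
  refine Real.rpow_le_rpow_of_nonpos (by positivity) ?_ (by linarith)
  nlinarith [sq_nonneg r]

theorem abs_gain_mul_le {g : ℝ} (hg : 0 ≤ g) (hg' : g ≤ 1) (r h : ℝ) :
    |p.meanPower r * g * h| ≤ p.meanPower 0 * |h| := by
  have h0 := (p.meanPower_pos r).le
  rw [abs_mul, abs_of_nonneg (mul_nonneg h0 hg)]
  gcongr
  exact (mul_le_of_le_one_right h0 hg').trans (p.meanPower_le r)

theorem integrable_fading : Integrable (fun h : ℝ => h) p.fadingLaw :=
  integrable_id_gammaMeasure p.m_pos p.m_pos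

theorem ae_fading_ne {a : ℝ} (ha : a ≠ 0) (T : ℝ) : ∀ᵐ h ∂p.fadingLaw, a * h ≠ T := by
  have : NullSingletonClass p.fadingLaw := instNullSingletonClassGammaMeasure _ _
  filter_upwards [Measure.ae_ne p.fadingLaw (T / a)] with h hh heq
  exact hh (by field_simp; linarith)

theorem ae_markLaw_of_forall {P : ℂ × ℝ × ℝ → Prop} (hP : MeasurableSet {y | P y})
    (h : ∀ x ξ, ∀ᵐ t ∂p.fadingLaw, P (x, ξ, t)) : ∀ᵐ y ∂p.markLaw, P y := by
  unfold markLaw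
  refine (Measure.ae_prod_iff_ae_ae hP).2 (Eventually.of_forall fun x => ?_)
  have hP' : MeasurableSet {w : ℝ × ℝ | P (x, w)} := hP.preimage measurable_prodMk_left
  exact (Measure.ae_prod_iff_ae_ae hP').2 (Eventually.of_forall fun ξ => h x ξ)

/-- For fixed position and beam, the power is a constant times the fading: either the constant
vanishes and nothing is claimed, or the power has no atom. -/
theorem ae_markPower_add_ne (t T : ℝ) :
    ∀ᵐ y ∂p.markLaw, p.markPower y ≠ 0 → p.markPower y + t ≠ T := by
  have hP : MeasurableSet {y | p.markPower y ≠ 0 → p.markPower y + t ≠ T} := by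
    have e : {y | p.markPower y ≠ 0 → p.markPower y + t ≠ T} =
        {y | p.markPower y = 0} ∪ {y | p.markPower y + t = T}ᶜ := by
      ext y
      simp only [mem_ofPred_eq, mem_union, mem_compl_iff]
      tauto
    rw [e]
    exact (measurableSet_eq_fun p.measurable_markPower measurable_const).union
      (measurableSet_eq_fun (p.measurable_markPower.add_const t) measurable_const).compl
  refine p.ae_markLaw_of_forall hP fun x ξ => ?_
  simp only [markPower]
  by_cases ha : p.meanPower ‖x‖ * p.G ξ = 0
  · simp [ha]
  · filter_upwards [p.ae_fading_ne ha (T - t)] with h hh _ heq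
    exact hh (by linarith)

theorem integral_cexp_fading (q c : ℝ) :
    ∫ w : ℝ × ℝ, Complex.exp (Complex.I * q * ((c * w.2 : ℝ) : ℂ)) ∂(beamLaw.prod p.fadingLaw) =
      (1 - Complex.I * q * c / p.m) ^ (-(p.m : ℂ)) := by
  have h := integral_fun_snd (μ := beamLaw) (ν := p.fadingLaw)
    (fun h : ℝ => Complex.exp (Complex.I * q * ((c * h : ℝ) : ℂ)))
  rw [h, probReal_univ, one_smul]
  have h2 := integral_cexp_gammaMeasure p.m_pos p.m_pos (q * c)
  rw [fadingLaw]
  simp only [Complex.ofReal_mul, ← mul_assoc] at h2 ⊢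
  exact h2

theorem lintegral_abs_markPower_lt_top :
    ∫⁻ y, ENNReal.ofReal |p.markPower y| ∂p.markLaw < ∞ := by
  have hi : Integrable (fun y : ℂ × ℝ × ℝ => y.2.2) p.markLaw := by
    unfold markLaw
    exact (p.integrable_fading.comp_snd beamLaw).comp_snd _
  have h2 : Integrable p.markPower p.markLaw := by
    refine Integrable.mono' (hi.abs.const_mul (p.meanPower 0))
      p.measurable_markPower.aestronglyMeasurable (Eventually.of_forall fun y => ?_)
    exact p.abs_gain_mul_le (p.G_nonneg _) (p.G_le_one _) _ _
  have := h2.hasFiniteIntegral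
  rwa [hasFiniteIntegral_iff_norm] at this

end Params

/-! ### Integrability and atoms of the total power -/

namespace Network

variable {p : Params} {Ω : Type*} [MeasurableSpace Ω] {μ : Measure Ω} (S : Network p μ)

/-- Wald's identity bounds the mean by the mean number of BSs times the mean absolute power of one;
`poissonMeasure_succ` computes the former. -/
theorem integrable_emfeRandom [IsProbabilityMeasure μ] : Integrable S.emfeRandom μ := by
  refine ⟨S.measurable_emfeRandom.aestronglyMeasurable, ?_⟩
  rw [hasFiniteIntegral_iff_norm]
  have hm : Measurable fun y => ENNReal.ofReal |p.markPower y| :=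
    p.measurable_markPower.abs.ennreal_ofReal
  set f : ℕ → (ℕ → ℂ × ℝ × ℝ) → ℝ≥0∞ := fun n m =>
    ∑ k ∈ Finset.range n, ENNReal.ofReal |p.markPower (m k)| with hf
  have hfm : ∀ n, Measurable (f n) := fun n =>
    Finset.measurable_fun_sum _ fun k _ => hm.comp (measurable_pi_apply k)
  have hle : ∀ ω, ENNReal.ofReal ‖S.emfeRandom ω‖ ≤ f (S.N ω) (S.marks ω) := by
    intro ω
    simp only [emfeRandom_eq, hf]
    rw [← ENNReal.ofReal_sum_of_nonneg fun _ _ => abs_nonneg _]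
    exact ENNReal.ofReal_le_ofReal (Finset.abs_sum_le_sum_abs _ _)
  refine (lintegral_mono hle).trans_lt ?_
  set C := ∫⁻ y, ENNReal.ofReal |p.markPower y| ∂p.markLaw
  have hterm : ∀ n, ∫⁻ ω, f n (S.marks ω) ∂μ = n * C := by
    intro n
    have hk : ∀ k, Measurable fun ω => ENNReal.ofReal |p.markPower (S.marks ω k)| := fun k =>
      hm.comp (S.measurable_mark k)
    have hC : ∀ k, ∫⁻ ω, ENNReal.ofReal |p.markPower (S.marks ω k)| ∂μ = C := fun k => by
      simp only [C]
      rw [← S.map_mark_eq k, lintegral_map hm (S.measurable_mark k)]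
      rfl
    simp only [f]
    rw [lintegral_finsetSum _ fun k _ => hk k, Finset.sum_congr rfl fun k _ => hC k]
    simp
  rw [S.lintegral_N_marks hfm, tsum_eq_zero_add' ENNReal.summable]
  simp only [hterm, ← mul_assoc, poissonMeasure_succ]
  rw [ENNReal.tsum_mul_right, ENNReal.tsum_mul_left]
  have h1 : ∑' n, poissonMeasure p.meanCount {n} = 1 := by
    have h := lintegral_countable' (μ := poissonMeasure p.meanCount) (fun _ => 1)
    simpa using h.symm
  rw [h1]
  simp only [Nat.cast_zero, mul_zero, zero_mul, zero_add, mul_one]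
  exact ENNReal.mul_lt_top ENNReal.coe_lt_top p.lintegral_abs_markPower_lt_top

/-- The total power has no atom except possibly at zero. -/
theorem ae_emfeRandom_ne [IsProbabilityMeasure μ] {T : ℝ} (hT : T ≠ 0) :
    ∀ᵐ ω ∂μ, S.emfeRandom ω ≠ T := by
  classical
  -- The power of BS `k` is independent of the power from `s`; with the latter fixed, the fading of
  -- `k` avoids the single forbidden value.
  have key : ∀ (s : Finset ℕ) (k : ℕ), k ∉ s → ∀ᵐ ω ∂μ, p.markPower (S.mark k ω) ≠ 0 →
      p.markPower (S.mark k ω) + ∑ j ∈ s, p.markPower (S.mark j ω) ≠ T := by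
    intro s k hk
    set R : Ω → ℝ := fun ω => ∑ j ∈ s, p.markPower (S.mark j ω) with hR
    have hRm : Measurable R :=
      Finset.measurable_fun_sum _ fun j _ => p.measurable_markPower.comp (S.measurable_mark j)
    have hind := S.iIndepFun_mark.indepFun_finset {k} s (by simpa using hk) S.measurable_mark
    have hind' : IndepFun (S.mark k) R μ := by
      have hφ : Measurable fun f : ({k} : Finset ℕ) → ℂ × ℝ × ℝ => f ⟨k, by simp⟩ :=
        measurable_pi_apply _
      have hψ : Measurable fun f : s → ℂ × ℝ × ℝ => ∑ j, p.markPower (f j) :=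
        Finset.measurable_fun_sum _ fun j _ => p.measurable_markPower.comp (measurable_pi_apply j)
      have h := hind.comp hφ hψ
      have e : R = (fun f : s → ℂ × ℝ × ℝ => ∑ j, p.markPower (f j)) ∘
          fun ω (j : s) => S.mark j ω := by
        ext ω
        exact (Finset.sum_coe_sort s fun j => p.markPower (S.mark j ω)).symm
      rw [e]
      exact h
    have hlaw := (indepFun_iff_map_prod_eq_prod_map_map (S.measurable_mark k).aemeasurable
      hRm.aemeasurable).1 hind'
    have hprob := Measure.isProbabilityMeasure_map (μ := μ) hRm.aemeasurable
    have hset : MeasurableSet {z : (ℂ × ℝ × ℝ) × ℝ |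
        p.markPower z.1 ≠ 0 → p.markPower z.1 + z.2 ≠ T} := by
      have h1 : Measurable fun z : (ℂ × ℝ × ℝ) × ℝ => p.markPower z.1 :=
        p.measurable_markPower.comp measurable_fst
      have e : {z : (ℂ × ℝ × ℝ) × ℝ | p.markPower z.1 ≠ 0 → p.markPower z.1 + z.2 ≠ T} =
          {z | p.markPower z.1 = 0} ∪ {z | p.markPower z.1 + z.2 = T}ᶜ := by
        ext z
        simp only [mem_ofPred_eq, mem_union, mem_compl_iff]
        tauto
      rw [e]
      exact (measurableSet_eq_fun h1 measurable_const).union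
        (measurableSet_eq_fun (h1.add measurable_snd) measurable_const).compl
    have hae : ∀ᵐ z ∂(p.markLaw.prod (μ.map R)),
        p.markPower z.1 ≠ 0 → p.markPower z.1 + z.2 ≠ T := by
      rw [Measure.ae_prod_iff_ae_ae hset, Measure.ae_ae_comm (p := fun y t =>
        p.markPower y ≠ 0 → p.markPower y + t ≠ T) hset]
      exact Eventually.of_forall fun t => p.ae_markPower_add_ne t T
    rw [← S.map_mark_eq k, ← hlaw] at hae
    exact ae_of_ae_map ((S.measurable_mark k).prodMk hRm).aemeasurable hae
  have key' : ∀ᵐ ω ∂μ, ∀ (s : Finset ℕ) (k : ℕ), k ∉ s → p.markPower (S.mark k ω) ≠ 0 →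
      p.markPower (S.mark k ω) + ∑ j ∈ s, p.markPower (S.mark j ω) ≠ T := by
    rw [ae_all_iff]; intro s
    rw [ae_all_iff]; intro k
    by_cases hk : k ∈ s
    · simp [hk]
    · filter_upwards [key s k hk] with ω hω _ using hω
  filter_upwards [key'] with ω hω heq
  rw [emfeRandom_eq] at heq
  -- A sum equal to `T ≠ 0` has a nonzero term, which is isolated; the exceptional sets over all
  -- `(s, k)` are countably many.
  obtain ⟨k, hk, hk0⟩ := Finset.exists_ne_zero_of_sum_ne_zero (heq.trans_ne hT)
  rw [← Finset.add_sum_erase _ _ hk] at heq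
  exact hω _ k (Finset.notMem_erase k _) hk0 heq

/-! ### Averaging conditional inversion formulas over the serving distance -/

variable [IsProbabilityMeasure μ]

theorem integrable_interferenceKernel (r : ℝ) :
    Integrable (fun t : ℝ => t) (S.interferenceKernel r) := by
  rw [interferenceKernel_apply, integrable_map_measure (g := fun t : ℝ => t)
    measurable_id.aestronglyMeasurable
    S.measurable_emfeRandom.aemeasurable]
  have h : Integrable S.emfeRandom (μ[|S.clear r]) := by
    rw [ProbabilityTheory.cond]
    exact S.integrable_emfeRandom.restrict.smul_measure
      (ENNReal.inv_ne_top.2 (S.measure_clear_pos r).ne')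
  exact h

theorem ae_interferenceKernel_ne (r : ℝ) {T : ℝ} (hT : T ≠ 0) :
    ∀ᵐ t ∂S.interferenceKernel r, t ≠ T := by
  have hset : MeasurableSet {t | t ≠ T} := (measurableSet_singleton T).compl
  rw [interferenceKernel_apply, ae_map_iff S.measurable_emfeRandom.aemeasurable hset]
  exact cond_absolutelyContinuous.ae_le (S.ae_emfeRandom_ne hT)

theorem integral_cexp_interferenceKernel {r : ℝ} (hr : p.re ≤ r) (hr' : r ≤ p.tau) (q : ℝ) :
    ∫ t : ℝ, Complex.exp (Complex.I * q * t) ∂S.interferenceKernel r = p.cfInterference q r := by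
  rw [interferenceKernel_apply, integral_map S.measurable_emfeRandom.aemeasurable
    (Measurable.aestronglyMeasurable (by fun_prop)), S.integral_cond_clear_cexp hr hr']

/-- Conditional characteristic function of the sum of a signal and of the interference. -/
theorem integral_cexp_condLaw {r : ℝ} (hr : p.re ≤ r) (hr' : r ≤ p.tau) (q : ℝ)
    (s : ℝ × ℝ → ℝ) :
    ∫ v : (ℝ × ℝ) × ℝ, Complex.exp (Complex.I * q * ((s v.1 + v.2 : ℝ) : ℂ)) ∂S.condLaw r =
      (∫ w, Complex.exp (Complex.I * q * s w) ∂(Params.beamLaw.prod p.fadingLaw)) *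
        p.cfInterference q r := by
  rw [condLaw_apply, ← S.integral_cexp_interferenceKernel hr hr' q, ← integral_prod_mul]
  congr 1
  ext v
  rw [← Complex.exp_add]
  push_cast
  ring_nf

/-- Joint law of the angle of the serving BS, of its beam direction and fading, and of the
interference, given the distance to the serving BS. -/
noncomputable def polarLaw : Kernel ℝ (ℝ × ((ℝ × ℝ) × ℝ)) :=
  (Kernel.const ℝ angleLaw) ×ₖ S.condLaw

theorem polarLaw_apply (r : ℝ) : S.polarLaw r = angleLaw.prod (S.condLaw r) := by
  rw [polarLaw, Kernel.prod_apply, Kernel.const_apply]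

instance isMarkovKernel_polarLaw : IsMarkovKernel S.polarLaw := by
  unfold polarLaw
  infer_instance

theorem served_apply {B : Set (ℂ × ((ℝ × ℝ) × ℝ))} (hB : MeasurableSet B) :
    S.served {ω | (S.X₀ ω, S.environment ω) ∈ B} =
      ∫⁻ r, ENNReal.ofReal (p.servingDensity r) *
        S.polarLaw r {z | (polarPoint r z.1, z.2) ∈ B} := by
  have h1 : S.served {ω | (S.X₀ ω, S.environment ω) ∈ B} =
      S.served.map (fun ω => (S.X₀ ω, S.environment ω)) B := by
    rw [Measure.map_apply (S.measurable_X₀.prodMk S.measurable_environment) hB]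
    rfl
  have := Measure.isProbabilityMeasure_map (μ := S.served) S.measurable_X₀.aemeasurable
  rw [h1, S.map_X₀_environment, Measure.compProd_apply hB, S.map_X₀, S.lintegral_servingLaw
    (Kernel.measurable_kernel_prodMk_left
      (κ := S.condLaw.comap (fun x : ℂ => ‖x‖) measurable_norm) hB)]
  refine lintegral_congr fun r => ?_
  by_cases hr : r ∈ Ioo p.re p.tau
  · congr 1
    have hm : MeasurableSet {z : ℝ × ((ℝ × ℝ) × ℝ) | (polarPoint r z.1, z.2) ∈ B} :=
      hB.preimage (((measurable_polarPoint.comp measurable_prodMk_left).comp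
        measurable_fst).prodMk measurable_snd)
    rw [S.polarLaw_apply, Measure.prod_apply hm]
    simp only [Kernel.comap_apply, norm_polarPoint, abs_of_pos (p.re_nonneg.trans_lt hr.1)]
    rfl
  · rw [Params.servingDensity, indicator_of_notMem hr, ENNReal.ofReal_zero, zero_mul, zero_mul]

theorem servingDensity_nonneg (r : ℝ) : 0 ≤ p.servingDensity r := by
  refine indicator_nonneg (fun s hs => ?_) r
  have h0 : 0 < s := p.re_nonneg.trans_lt hs.1
  have h1 := p.lam_pos
  have h2 := p.re_nonneg
  have h3 := p.re_lt_tau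
  have h4 : Real.exp (-p.lam * Real.pi * p.tau ^ 2) ≤ Real.exp (-p.lam * Real.pi * p.re ^ 2) := by
    rw [Real.exp_le_exp]
    have : p.re ^ 2 ≤ p.tau ^ 2 := by nlinarith
    have : 0 < p.lam * Real.pi := by positivity
    nlinarith
  have h5 := sub_nonneg.2 h4
  positivity

/-- The density is that of `R₀` under a probability measure, so its total mass needs no computation.
-/
theorem lintegral_servingDensity (S : Network p μ) :
    ∫⁻ r, ENNReal.ofReal (p.servingDensity r) = 1 := by
  have h := congrArg (fun ν : Measure ℝ => ν univ) S.map_R₀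
  have hp := Measure.isProbabilityMeasure_map (μ := S.served) (f := S.R₀)
    S.measurable_X₀.norm.aemeasurable
  simp only [measure_univ, withDensity_apply _ MeasurableSet.univ, Measure.restrict_univ] at h
  exact h.symm

theorem integrable_servingDensity (S : Network p μ) : Integrable p.servingDensity := by
  refine ⟨p.measurable_servingDensity.aestronglyMeasurable, ?_⟩
  rw [hasFiniteIntegral_iff_ofReal (Eventually.of_forall servingDensity_nonneg),
    S.lintegral_servingDensity]
  exact ENNReal.one_lt_top

theorem integral_servingDensity (S : Network p μ) : ∫ r, p.servingDensity r = 1 := by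
  rw [integral_eq_lintegral_of_nonneg_ae (Eventually.of_forall servingDensity_nonneg)
    p.measurable_servingDensity.aestronglyMeasurable, S.lintegral_servingDensity,
    ENNReal.toReal_one]

/-- An average over the distance of the serving BS of conditional Gil-Pelaez formulas. -/
theorem isGilPelaezAverage_of_conditional (S : Network p μ) {φ : ℝ → ℝ → ℂ} {T : ℝ} {Φ : ℝ → ℝ}
    (hΦm : Measurable Φ) (hΦ0 : ∀ r, 0 ≤ Φ r) (hΦ1 : ∀ r, Φ r ≤ 1)
    (h : ∀ r ∈ Ioo p.re p.tau, HasImproperIntegral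
      (fun q => 1 / (Real.pi * q) * (φ q r * Complex.exp (-Complex.I * q * T)).im) (1 / 2 - Φ r)) :
    IsGilPelaezAverage p φ T (∫ r, p.servingDensity r * Φ r) := by
  have hi := S.integrable_servingDensity
  have hi2 : Integrable fun r => p.servingDensity r * Φ r :=
    hi.mul_bdd (c := 1) hΦm.aestronglyMeasurable (Eventually.of_forall fun r => by
      rw [Real.norm_eq_abs, abs_of_nonneg (hΦ0 r)]; exact hΦ1 r)
  have e : (fun r => (1 / 2 - Φ r) * p.servingDensity r) =
      fun r => 1 / 2 * p.servingDensity r - p.servingDensity r * Φ r := by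
    ext r; ring
  have hi3 : Integrable fun r => (1 / 2 - Φ r) * p.servingDensity r := by
    rw [e]
    exact (hi.const_mul _).sub hi2
  -- The density has mass one and vanishes off `(re, tau)`, so averaging `1/2 - Φ` gives `1/2` minus
  -- the average of `Φ`.
  refine ⟨fun r => 1 / 2 - Φ r, h, hi3.integrableOn, ?_⟩
  rw [intervalIntegral.integral_of_le p.re_lt_tau.le, integral_Ioc_eq_integral_Ioo,
    setIntegral_eq_integral_of_forall_compl_eq_zero fun r hr => by
      rw [Params.servingDensity, indicator_of_notMem hr, mul_zero],
    e, integral_sub (hi.const_mul _) hi2, integral_const_mul, S.integral_servingDensity]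
  ring

theorem half_sub_measureReal {α : Type*} [MeasurableSpace α] {π : Measure α}
    [IsProbabilityMeasure π] {Y : α → ℝ} (hY : Measurable Y) {T : ℝ} (h : ∀ᵐ a ∂π, Y a ≠ T) :
    (π.real {a | T < Y a} - π.real {a | Y a < T}) / 2 = 1 / 2 - π.real {a | Y a < T} := by
  have hm : MeasurableSet {a | Y a < T} := measurableSet_lt hY measurable_const
  have e : π.real {a | T < Y a} = π.real {a | Y a < T}ᶜ := by
    refine measureReal_congr ?_
    filter_upwards [h] with a ha
    refine propext (show T < Y a ↔ ¬ (Y a < T) from ?_)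
    rw [not_lt]
    exact ⟨le_of_lt, fun h' => lt_of_le_of_ne h' (Ne.symm ha)⟩
  rw [e, probReal_compl_eq_one_sub hm]
  ring

/-- Distribution of the sum of a signal from the serving BS and of the interference. -/
theorem isGilPelaezAverage_served {s : ℂ × (ℝ × ℝ) → ℝ} (hs : Measurable s) {C : ℝ}
    (hC : ∀ x w, |s (x, w)| ≤ C * |w.2|) {φ : ℝ → ℝ → ℂ} {T : ℝ}
    (hφ : ∀ q : ℝ, ∀ r ∈ Ioo p.re p.tau, ∫ z, Complex.exp (Complex.I * q *
      ((s (polarPoint r z.1, z.2.1) + z.2.2 : ℝ) : ℂ)) ∂S.polarLaw r = φ q r)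
    (hne : ∀ r ∈ Ioo p.re p.tau, ∀ᵐ z ∂S.polarLaw r,
      s (polarPoint r z.1, z.2.1) + z.2.2 ≠ T) :
    IsGilPelaezAverage p φ T
      (S.served.real {ω | s (S.X₀ ω, (S.environment ω).1) + S.interference ω < T}) := by
  set B : Set (ℂ × ((ℝ × ℝ) × ℝ)) := {b | s (b.1, b.2.1) + b.2.2 < T} with hBdef
  have hB : MeasurableSet B :=
    measurableSet_lt ((hs.comp (by fun_prop)).add (by fun_prop)) measurable_const
  set Φ : ℝ → ℝ := fun r => (S.polarLaw r).real {z | (polarPoint r z.1, z.2) ∈ B} with hΦ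
  have hmap : Measurable fun a : ℝ × (ℝ × ((ℝ × ℝ) × ℝ)) => (polarPoint a.1 a.2.1, a.2.2) :=
    (measurable_polarPoint.comp (by fun_prop : Measurable fun a : ℝ × (ℝ × ((ℝ × ℝ) × ℝ)) =>
      (a.1, a.2.1))).prodMk (by fun_prop)
  have hΦm : Measurable Φ :=
    (Kernel.measurable_kernel_prodMk_left (κ := S.polarLaw) (hB.preimage hmap)).ennreal_toReal
  have hprob : S.served.real {ω | s (S.X₀ ω, (S.environment ω).1) + S.interference ω < T} =
      ∫ r, p.servingDensity r * Φ r := by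
    have h1 := S.served_apply hB
    rw [integral_eq_lintegral_of_nonneg_ae (Eventually.of_forall fun r =>
      mul_nonneg (servingDensity_nonneg r) measureReal_nonneg)
      (p.measurable_servingDensity.mul hΦm).aestronglyMeasurable, measureReal_def]
    congr 1
    refine Eq.trans ?_ (h1.trans ?_)
    · rfl
    · refine lintegral_congr fun r => ?_
      rw [ENNReal.ofReal_mul (servingDensity_nonneg r), ofReal_measureReal]
  rw [hprob]
  refine S.isGilPelaezAverage_of_conditional hΦm (fun r => measureReal_nonneg)
    (fun r => measureReal_le_one) fun r hr => ?_
  set Y : ℝ × ((ℝ × ℝ) × ℝ) → ℝ := fun z => s (polarPoint r z.1, z.2.1) + z.2.2 with hY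
  have hYs : Measurable fun z : ℝ × ((ℝ × ℝ) × ℝ) => s (polarPoint r z.1, z.2.1) :=
    hs.comp ((measurable_polarPoint.comp (measurable_const.prodMk measurable_fst)).prodMk
      (by fun_prop))
  have hYm : Measurable Y := hYs.add (by fun_prop)
  have hYi : Integrable Y (S.polarLaw r) := by
    rw [S.polarLaw_apply, S.condLaw_apply]
    refine Integrable.add ?_ (((S.integrable_interferenceKernel r).comp_snd _).comp_snd _)
    -- The signal is dominated by `C` times the fading, whose mean is finite.
    have h1 : Integrable (fun z : ℝ × ((ℝ × ℝ) × ℝ) => z.2.1.2)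
        (angleLaw.prod ((Params.beamLaw.prod p.fadingLaw).prod (S.interferenceKernel r))) :=
      ((p.integrable_fading.comp_snd Params.beamLaw).comp_fst (S.interferenceKernel r)).comp_snd _
    exact Integrable.mono' (h1.abs.const_mul C) hYs.aestronglyMeasurable
      (Eventually.of_forall fun z => hC _ _)
  have h := hasImproperIntegral_gilPelaez hYm hYi T fun q => hφ q r hr
  rwa [half_sub_measureReal hYm (hne r hr)] at h

/-- The sum of a signal and of the interference has no atom at `T`, if the interference has none or
if the gain of the signal does not vanish. -/
theorem ae_signal_add_interference_ne {a : ℂ × ℝ → ℝ} (ha : Measurable a) {T : ℝ}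
    (h : T ≠ 0 ∨ ∀ b, a b ≠ 0) (r : ℝ) :
    ∀ᵐ z ∂S.polarLaw r, a (polarPoint r z.1, z.2.1.1) * z.2.1.2 + z.2.2 ≠ T := by
  have ha' : Measurable fun z : ℝ × ((ℝ × ℝ) × ℝ) => a (polarPoint r z.1, z.2.1.1) :=
    ha.comp ((measurable_polarPoint.comp (measurable_const.prodMk measurable_fst)).prodMk
      (by fun_prop))
  have hset : MeasurableSet {z : ℝ × ((ℝ × ℝ) × ℝ) |
      a (polarPoint r z.1, z.2.1.1) * z.2.1.2 + z.2.2 ≠ T} :=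
    (measurableSet_eq_fun ((ha'.mul (by fun_prop)).add (by fun_prop)) measurable_const).compl
  rw [S.polarLaw_apply, S.condLaw_apply, Measure.ae_prod_iff_ae_ae hset]
  refine Eventually.of_forall fun θ => ?_
  have hset1 : MeasurableSet {v : (ℝ × ℝ) × ℝ | a (polarPoint r θ, v.1.1) * v.1.2 + v.2 ≠ T} :=
    hset.preimage (measurable_prodMk_left (x := θ))
  simp only
  rw [Measure.ae_prod_iff_ae_ae hset1]
  simp only
  -- The interference is fixed first, so that the fading is the last variable; where the gain
  -- vanishes, only the interference can avoid `T`.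
  rw [Measure.ae_ae_comm (p := fun (w : ℝ × ℝ) (t : ℝ) =>
    a (polarPoint r θ, w.1) * w.2 + t ≠ T) hset1]
  have hmain : ∀ t : ℝ, (t ≠ T ∨ ∀ b, a b ≠ 0) →
      ∀ᵐ w ∂(Params.beamLaw.prod p.fadingLaw), a (polarPoint r θ, w.1) * w.2 + t ≠ T := by
    intro t ht
    have hset2 : MeasurableSet {w : ℝ × ℝ | a (polarPoint r θ, w.1) * w.2 + t ≠ T} :=
      hset1.preimage (measurable_prodMk_right (y := t))
    rw [Measure.ae_prod_iff_ae_ae hset2]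
    refine Eventually.of_forall fun ξ => ?_
    by_cases h0 : a (polarPoint r θ, ξ) = 0
    · have : t ≠ T := ht.resolve_right fun hb => hb _ h0
      refine Eventually.of_forall fun x => ?_
      simpa [h0] using this
    · filter_upwards [p.ae_fading_ne h0 (T - t)] with x hx heq
      exact hx (by linarith)
  rcases h with hT | hb
  · filter_upwards [S.ae_interferenceKernel_ne r hT] with t ht using hmain t (Or.inl ht)
  · exact Eventually.of_forall fun t => hmain t (Or.inr hb)

end Network

/-! ### Amplitudes of the signals of the active and idle users -/

@[fun_prop]
theorem measurable_idleDist (d : ℝ) : Measurable (idleDist d) := by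
  have h := Complex.measurable_arg
  unfold idleDist
  fun_prop

@[fun_prop]
theorem measurable_idleAngle (d : ℝ) : Measurable (idleAngle d) := by
  have h := Complex.measurable_arg
  have hd := measurable_idleDist d
  have hs : Measurable Real.sign := by
    unfold Real.sign
    exact Measurable.ite measurableSet_Iio measurable_const
      (Measurable.ite measurableSet_Ioi measurable_const measurable_const)
  have ha := Real.continuous_arccos.measurable
  unfold idleAngle
  exact (hs.comp h).mul (ha.comp (by fun_prop))

theorem integral_angleLaw (f : ℝ → ℂ) :
    ∫ θ, f θ ∂angleLaw =
      ((1 / (2 * Real.pi) : ℝ) : ℂ) * ∫ θ in (0 : ℝ)..(2 * Real.pi), f θ := by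
  rw [angleLaw, ProbabilityTheory.cond, integral_smul_measure, volume_angle, ENNReal.toReal_inv,
    ENNReal.toReal_ofReal (by positivity), Complex.real_smul, one_div,
    intervalIntegral.integral_of_le (by positivity)]

namespace Params

variable (p : Params)

/-- Mean useful power of the active user, the serving BS being at `b.1`. -/
noncomputable def activeAmplitude (b : ℂ × ℝ) : ℝ := p.meanPower ‖b.1‖ * p.G 0

open Classical in
/-- Mean signal power of the idle user, the serving BS being at `b.1` with a beam in the
direction `b.2` outside of the sector of the active user. -/
noncomputable def idleAmplitude (d : ℝ) (b : ℂ × ℝ) : ℝ :=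
  p.meanPower (idleDist d b.1) *
    if |idleAngle d b.1| ≤ Real.pi / 3 then p.G (idleAngle d b.1) else p.G b.2

theorem measurable_activeAmplitude : Measurable p.activeAmplitude := by
  unfold activeAmplitude
  exact (p.measurable_meanPower.comp (by fun_prop)).mul_const _

theorem measurable_idleAmplitude (d : ℝ) : Measurable (p.idleAmplitude d) := by
  have h1 : Measurable fun b : ℂ × ℝ => idleAngle d b.1 :=
    (measurable_idleAngle d).comp measurable_fst
  unfold idleAmplitude
  refine (p.measurable_meanPower.comp ((measurable_idleDist d).comp measurable_fst)).mul ?_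
  exact Measurable.ite (measurableSet_le h1.abs measurable_const) (p.measurable_G.comp h1)
    (p.measurable_G.comp measurable_snd)

theorem abs_activeAmplitude_mul_le (b : ℂ × ℝ) (h : ℝ) :
    |p.activeAmplitude b * h| ≤ p.meanPower 0 * |h| :=
  p.abs_gain_mul_le (p.G_nonneg _) (p.G_le_one _) _ _

theorem abs_idleAmplitude_mul_le (d : ℝ) (b : ℂ × ℝ) (h : ℝ) :
    |p.idleAmplitude d b * h| ≤ p.meanPower 0 * |h| := by
  unfold idleAmplitude
  split_ifs
  all_goals exact p.abs_gain_mul_le (p.G_nonneg _) (p.G_le_one _) _ _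

/-- Because `G 0 = 1`, the fading always smooths the exposure of the active user, and `T = 0` need
not be excluded. -/
theorem activeAmplitude_ne_zero (b : ℂ × ℝ) : p.activeAmplitude b ≠ 0 := by
  rw [activeAmplitude, p.G_zero, mul_one]
  exact (p.meanPower_pos _).ne'

theorem integral_cexp_activeAmplitude (q : ℝ) (x : ℂ) :
    ∫ w : ℝ × ℝ, Complex.exp (Complex.I * q * ((p.activeAmplitude (x, w.1) * w.2 : ℝ) : ℂ))
      ∂(beamLaw.prod p.fadingLaw) = p.cfSignalActive q ‖x‖ := by
  simp only [activeAmplitude, p.G_zero, mul_one]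
  exact p.integral_cexp_fading q _

theorem integral_cexp_idleAmplitude (q d : ℝ) (x : ℂ) :
    ∫ w : ℝ × ℝ, Complex.exp (Complex.I * q * ((p.idleAmplitude d (x, w.1) * w.2 : ℝ) : ℂ))
      ∂(beamLaw.prod p.fadingLaw) = p.cfSignalIdle q d x := by
  simp only [idleAmplitude, cfSignalIdle]
  split_ifs with h
  · rw [p.integral_cexp_fading]
    push_cast
    simp only [mul_assoc]
  · unfold etaS
    push_cast
    simp only [mul_assoc]

end Params

/-! ### Conditional characteristic functions and exposure distributions -/

namespace Network

variable {p : Params} {Ω : Type*} [MeasurableSpace Ω] {μ : Measure Ω} [IsProbabilityMeasure μ]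
  (S : Network p μ)

/-- Conditional characteristic function of a signal received from the serving BS. -/
theorem hasCondCF_signal {a : ℂ × ℝ → ℝ} (ha : Measurable a) {φ : ℝ → ℂ → ℂ}
    (hφ : ∀ (q : ℝ) (x : ℂ), ∫ w : ℝ × ℝ, Complex.exp (Complex.I * q *
      ((a (x, w.1) * w.2 : ℝ) : ℂ)) ∂(Params.beamLaw.prod p.fadingLaw) = φ q x) :
    S.HasCondCF (fun ω => a (S.X₀ ω, (S.environment ω).1.1) * (S.environment ω).1.2) φ := by
  refine S.hasCondCF_of_condLaw (y := fun z => a (z.1, z.2.1.1) * z.2.1.2)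
    ((ha.comp (by fun_prop)).mul (by fun_prop)) fun q x _ => ?_
  rw [condLaw_apply, integral_fun_fst (f := fun w : ℝ × ℝ => Complex.exp (Complex.I * q *
      ((a (x, w.1) * w.2 : ℝ) : ℂ))), probReal_univ, one_smul, hφ]

theorem hasCondCF_interference :
    S.HasCondCF S.interference (fun q x => p.cfInterference q ‖x‖) := by
  refine S.hasCondCF_of_condLaw (y := fun z => z.2.2) (by fun_prop) fun q x hx => ?_
  rw [condLaw_apply, integral_fun_snd (f := fun t : ℝ => Complex.exp (Complex.I * q * t)),
    probReal_univ, one_smul, S.integral_cexp_interferenceKernel hx.1.le hx.2.le]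

/-- Given the distance, the angle, the marks of the serving BS and the interference are independent:
the interference factors out and the signal is averaged over the angle. -/
theorem integral_cexp_polarLaw {a : ℂ × ℝ → ℝ} (ha : Measurable a) {r : ℝ}
    (hr : r ∈ Ioo p.re p.tau) (q : ℝ) :
    ∫ z, Complex.exp (Complex.I * q *
        ((a (polarPoint r z.1, z.2.1.1) * z.2.1.2 + z.2.2 : ℝ) : ℂ)) ∂S.polarLaw r =
      (∫ θ, ∫ w : ℝ × ℝ, Complex.exp (Complex.I * q *
        ((a (polarPoint r θ, w.1) * w.2 : ℝ) : ℂ)) ∂(Params.beamLaw.prod p.fadingLaw) ∂angleLaw) *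
        p.cfInterference q r := by
  have ha' : Measurable fun z : ℝ × ((ℝ × ℝ) × ℝ) => a (polarPoint r z.1, z.2.1.1) :=
    ha.comp ((measurable_polarPoint.comp (measurable_const.prodMk measurable_fst)).prodMk
      (by fun_prop))
  have hs : Measurable fun z : ℝ × ((ℝ × ℝ) × ℝ) =>
      a (polarPoint r z.1, z.2.1.1) * z.2.1.2 + z.2.2 := (ha'.mul (by fun_prop)).add (by fun_prop)
  have hi : Integrable (fun z : ℝ × ((ℝ × ℝ) × ℝ) => Complex.exp (Complex.I * q *
      ((a (polarPoint r z.1, z.2.1.1) * z.2.1.2 + z.2.2 : ℝ) : ℂ)))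
      (angleLaw.prod (S.condLaw r)) :=
    Integrable.of_bound (Complex.measurable_exp.comp
      ((Complex.measurable_ofReal.comp hs).const_mul _)).aestronglyMeasurable 1
      (Eventually.of_forall fun z => (Params.norm_cexp_I_mul _ _).le)
  rw [S.polarLaw_apply, integral_prod _ hi, ← integral_mul_const]
  congr 1
  ext θ
  exact S.integral_cexp_condLaw hr.1.le hr.2.le q fun w => a (polarPoint r θ, w.1) * w.2

theorem isGilPelaezAverage_emfeActive (T : ℝ) :
    IsGilPelaezAverage p p.cfActive T (S.served.real {ω | S.emfeActive ω < T}) := by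
  have ha := p.measurable_activeAmplitude
  refine S.isGilPelaezAverage_served (s := fun z => p.activeAmplitude (z.1, z.2.1) * z.2.2)
    ((ha.comp (by fun_prop)).mul (by fun_prop))
    (fun x w => p.abs_activeAmplitude_mul_le (x, w.1) w.2) (fun q r hr => ?_) fun r _ =>
    S.ae_signal_add_interference_ne ha (Or.inr p.activeAmplitude_ne_zero) r
  have h := S.integral_cexp_polarLaw ha hr q
  simp only [p.integral_cexp_activeAmplitude, norm_polarPoint,
    abs_of_pos (p.re_nonneg.trans_lt hr.1), integral_const, probReal_univ, one_smul] at h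
  exact h

theorem isGilPelaezAverage_emfeIdle (d : ℝ) {J : Ω → ℝ} (hJ : S.IsIdleInterference d J) {T : ℝ}
    (hT : T ≠ 0) : IsGilPelaezAverage p (p.cfIdle d) T
      (S.served.real {ω | S.signalIdle d ω + J ω < T}) := by
  have ha := p.measurable_idleAmplitude d
  have hB : MeasurableSet {z : ℂ × ℝ × ℝ | z.2.1 + z.2.2 < T} :=
    measurableSet_lt (by fun_prop) measurable_const
  -- Only the joint law with the signal matters, so the modelling convention lets `J` be replaced by
  -- the interference at the active user.
  have hlaw : S.served.real {ω | S.signalIdle d ω + J ω < T} =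
      S.served.real {ω | S.signalIdle d ω + S.interference ω < T} := by
    rw [measureReal_def, measureReal_def]
    exact congrArg ENNReal.toReal (hJ.measure_mem_eq hB)
  rw [hlaw]
  refine S.isGilPelaezAverage_served (s := fun z => p.idleAmplitude d (z.1, z.2.1) * z.2.2)
    ((ha.comp (by fun_prop)).mul (by fun_prop))
    (fun x w => p.abs_idleAmplitude_mul_le d (x, w.1) w.2) (fun q r hr => ?_) fun r _ =>
    S.ae_signal_add_interference_ne ha (Or.inl hT) r
  have h := S.integral_cexp_polarLaw ha hr q
  simp only [p.integral_cexp_idleAmplitude, integral_angleLaw] at h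
  exact h

theorem isGilPelaezAverage_emfeRandom {T : ℝ} (hT : T ≠ 0) :
    IsGilPelaezAverage p p.cfRandom T (μ.real {ω | S.emfeRandom ω < T}) := by
  -- The inner integral does not depend on the distance, so the average is taken of a constant.
  have h := S.isGilPelaezAverage_of_conditional (φ := p.cfRandom) (T := T)
    (Φ := fun _ => μ.real {ω | S.emfeRandom ω < T}) measurable_const
    (fun _ => measureReal_nonneg) (fun _ => measureReal_le_one) fun r _ => by
      rw [← half_sub_measureReal S.measurable_emfeRandom (S.ae_emfeRandom_ne hT)]
      exact hasImproperIntegral_gilPelaez S.measurable_emfeRandom S.integrable_emfeRandom T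
        S.integral_cexp_emfeRandom
  rwa [integral_mul_const, S.integral_servingDensity, one_mul] at h

end Network

end DownlinkEMFE

theorem theorem1 (p : DownlinkEMFE.Params) {Ω : Type*} [MeasurableSpace Ω] (μ : Measure Ω)
    [IsProbabilityMeasure μ] (S : DownlinkEMFE.Network p μ) :
    -- the functions in the formulas are the density of `R₀` and the characteristic functions
    S.served.map S.R₀ = volume.withDensity (fun r => ENNReal.ofReal (p.servingDensity r)) ∧
    S.HasCondCF S.signalActive (fun q x => p.cfSignalActive q ‖x‖) ∧
    (∀ d : ℝ, 0 ≤ d → S.HasCondCF (S.signalIdle d) (fun q x => p.cfSignalIdle q d x)) ∧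
    S.HasCondCF S.interference (fun q x => p.cfInterference q ‖x‖) ∧
    -- active user
    (∀ T : ℝ, DownlinkEMFE.IsGilPelaezAverage p p.cfActive T
      (S.served.real {ω | S.emfeActive ω < T})) ∧
    -- idle user at distance `d`
    (∀ d : ℝ, 0 ≤ d → ∀ J : Ω → ℝ, S.IsIdleInterference d J →
      ∀ T : ℝ, T ≠ 0 → DownlinkEMFE.IsGilPelaezAverage p (p.cfIdle d) T
        (S.served.real {ω | S.signalIdle d ω + J ω < T})) ∧
    -- random user
    (∀ q : ℝ, ∫ ω, Complex.exp (Complex.I * q * S.emfeRandom ω) ∂μ = p.cfInterference q p.re) ∧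
    (∀ T : ℝ, T ≠ 0 → DownlinkEMFE.IsGilPelaezAverage p p.cfRandom T
      (μ.real {ω | S.emfeRandom ω < T})) :=
  ⟨S.map_R₀,
    S.hasCondCF_signal p.measurable_activeAmplitude p.integral_cexp_activeAmplitude,
    fun d _ => S.hasCondCF_signal (p.measurable_idleAmplitude d)
      fun q x => p.integral_cexp_idleAmplitude q d x,
    S.hasCondCF_interference, S.isGilPelaezAverage_emfeActive,
    fun d _ _ hJ _ hT => S.isGilPelaezAverage_emfeIdle d hJ hT, S.integral_cexp_emfeRandom,
    fun _ hT => S.isGilPelaezAverage_emfeRandom hT⟩
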